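/- Let $a=(a_1,a_2)$ with $a_1,a_2>0$ and let $x_1,x_2>0$. For $\Re(w)>0$ let $$\zeta_2(s,w\,|\,a)=\frac1{\Gamma(s)}\int_0^\infty \frac{t^{s-1}e^{-wt}}{(1-e^{-a_1t})(1-e^{-a_2t})}\,dt\quad(\Re(s)>2),$$ which has a meromorphic continuation in $s$ that is holomorphic outside $s=1,2$, and let $L_2(w\,|\,a)=\partial_s\zeta_2(s,w\,|\,a)|_{s=0}$ and $\Gamma_2(w\,|\,a)=\exp(L_2(w\,|\,a))$ (the Barnes double gamma function). For real $b_0,b_1,b_2$ such that the numbers $b_0,\ b_0+b_1,\ b_0+b_2,\ b_0+b_1+b_2$ are positive, $\beta_{2,2}(a,b)$ denotes the probability distribution on $(0,1]$, if it exists (it is then unique), such that $$\mathbf E\bigl[\beta_{2,2}(a,b)^q\bigr]=\frac{\eta(q)}{\eta(0)},\qquad \eta(q)=\frac{\Gamma_2(q+b_0\,|\,a)\,\Gamma_2(q+b_0+b_1+b_2\,|\,a)}{\Gamma_2(q+b_0+b_1\,|\,a)\,\Gamma_2(q+b_0+b_2\,|\,a)},$$ for all $q\in\mathbb C$ with $\Re(q)>-\min(b_0,\,b_0+b_1,\,b_0+b_2,\,b_0+b_1+b_2)$.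 **Theorem.** There is a unique probability distribution $M_{(a,x)}$ on $(0,\infty)$ such that, for all $q\in\mathbb C$ with $\Re(q)<\min(x_1,x_2,a_1+a_2)$, $M_{(a,x)}^q$ is integrable and $$\mathbf E\bigl[M_{(a,x)}^q\bigr]=\frac{\Gamma_2(x_1-q\,|\,a)}{\Gamma_2(x_1\,|\,a)}\,\frac{\Gamma_2(x_2-q\,|\,a)}{\Gamma_2(x_2\,|\,a)}\,\frac{\Gamma_2(a_1+a_2-q\,|\,a)}{\Gamma_2(a_1+a_2\,|\,a)}\,\frac{\Gamma_2(x_1+x_2-q\,|\,a)}{\Gamma_2(x_1+x_2-2q\,|\,a)}.$$ The following three distributions $\beta_{2,2}(a,b)$ exist; let $X_1,X_2,X_3$ be distributed as their reciprocals: $$X_1=\beta_{2,2}^{-1}\Bigl(a,\ b_0=x_1,\ b_1=b_2=\tfrac{x_2-x_1}2\Bigr),\qquad X_2=\beta_{2,2}^{-1}\Bigl(a,\ b_0=\tfrac{x_1+x_2}2,\ b_1=\tfrac{a_1}2,\ b_2=\tfrac{a_2}2\Bigr),$$ $$X_3=\beta_{2,2}^{-1}\Bigl(a,\ b_0=a_1+a_2,\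 b_1=b_2=\tfrac{x_1+x_2-a_1-a_2}2\Bigr).$$ Let $L=\exp(\mathcal N)$ with $\mathcal N$ normal of mean $0$ and variance $4\log 2/(a_1a_2)$, and let $L,X_1,X_2,X_3$ be independent. Then $$M_{(a,x)}\overset{\text{in law}}{=}2^{-\left(2(x_1+x_2)-(a_1+a_2)\right)/(a_1a_2)}\,L\,X_1\,X_2\,X_3 .$$ Moreover, the distribution of $\log M_{(a,x)}$ is absolutely continuous (with respect to Lebesgue measure) and infinitely divisible. -/

import Mathlib

open MeasureTheory ProbabilityTheory

/-- The Barnes double zeta function with parameters `a₁, a₂ > 0` in its region of convergence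
`Re s > 2`, `Re w > 0`:
`ζ₂(s, w | a) = Γ(s)⁻¹ ∫₀^∞ t^(s-1) e^(-wt) / ((1 - e^(-a₁ t)) (1 - e^(-a₂ t))) dt`. -/
noncomputable def barnesZetaIntegral (a₁ a₂ : ℝ) (s w : ℂ) : ℂ :=
  (Complex.Gamma s)⁻¹ * ∫ t : ℝ in Set.Ioi 0,
    (t : ℂ) ^ (s - 1) * Complex.exp (-w * t) /
      ((1 - Complex.exp (-(a₁ * t))) * (1 - Complex.exp (-(a₂ * t))))

/-- `Z` is the analytic continuation of `s ↦ ζ₂(s, w | a)` from `Re s > 2` to the half-plane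
`Re s > -1` with the (possible) poles `1` and `2` removed. This domain is open and connected and
contains `0`, so that `Z` is determined on it by its values for `Re s > 2`, and it coincides there
with the meromorphic continuation to the whole plane. -/
def IsBarnesZetaContinuation (a₁ a₂ : ℝ) (w : ℂ) (Z : ℂ → ℂ) : Prop :=
  DifferentiableOn ℂ Z {s : ℂ | -1 < s.re ∧ s ≠ 1 ∧ s ≠ 2} ∧
    ∀ s : ℂ, 2 < s.re → Z s = barnesZetaIntegral a₁ a₂ s w

open Classical in
/-- The analytic continuation of `s ↦ ζ₂(s, w | a)`, for `a₁, a₂ > 0` and `Re w > 0`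
(only used on `Re s > -1`, `s ≠ 1, 2`). -/
noncomputable def barnesZeta (a₁ a₂ : ℝ) (s w : ℂ) : ℂ :=
  if h : ∃ Z : ℂ → ℂ, IsBarnesZetaContinuation a₁ a₂ w Z then h.choose s else 0

/-- The log-double-gamma function `L₂(w | a) = ∂ₛ ζ₂(s, w | a)` at `s = 0`, for `Re w > 0`. -/
noncomputable def barnesLogGamma (a₁ a₂ : ℝ) (w : ℂ) : ℂ :=
  deriv (fun s : ℂ => barnesZeta a₁ a₂ s w) 0

/-- The Barnes double gamma function `Γ₂(w | a) = exp (L₂(w | a))`, for `Re w > 0`. -/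
noncomputable def barnesGamma (a₁ a₂ : ℝ) (w : ℂ) : ℂ :=
  Complex.exp (barnesLogGamma a₁ a₂ w)

/-- `(𝒮₂ h)(q | b) = h(q+b₀) - h(q+b₀+b₁) - h(q+b₀+b₂) + h(q+b₀+b₁+b₂)`. -/
noncomputable def barnesS (h : ℂ → ℂ) (b₀ b₁ b₂ : ℝ) (q : ℂ) : ℂ :=
  h (q + b₀) - h (q + b₀ + b₁) - h (q + b₀ + b₂) + h (q + b₀ + b₁ + b₂)

/-- `η₂,₂(q | a, b) = exp ((𝒮₂ L₂)(q | b) - (𝒮₂ L₂)(0 | b))`. -/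
noncomputable def barnesEta (a₁ a₂ b₀ b₁ b₂ : ℝ) (q : ℂ) : ℂ :=
  Complex.exp (barnesS (barnesLogGamma a₁ a₂) b₀ b₁ b₂ q -
    barnesS (barnesLogGamma a₁ a₂) b₀ b₁ b₂ 0)

/-- `ν` is a probability measure carried by `S ⊆ (0, ∞)` whose Mellin transform
`q ↦ E[Y^q]` exists and equals `φ q` at every `q ∈ D`. -/
structure IsLawWithMellin (ν : Measure ℝ) (S : Set ℝ) (D : Set ℂ) (φ : ℂ → ℂ) : Prop where
  isProbabilityMeasure : IsProbabilityMeasure ν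
  support : ν Sᶜ = 0
  integrable : ∀ q ∈ D, Integrable (fun y : ℝ => (y : ℂ) ^ q) ν
  mellin : ∀ q ∈ D, ∫ y : ℝ, (y : ℂ) ^ q ∂ν = φ q

/-- `ν` is the Barnes beta distribution `β₂,₂(a, b)`: the law on `(0, 1]` with Mellin transform
`η₂,₂(q | a, b)` for all `q` such that the four arguments of `L₂` lie in the right half-plane.
For `b₁, b₂ ≥ 0` this means `Re q > -b₀`; parameters `b₁, b₂ ≤ 0` with `b₀ + b₁ + b₂ > 0` are
allowed too. -/
def IsBarnesBeta (a₁ a₂ b₀ b₁ b₂ : ℝ) (ν : Measure ℝ) : Prop :=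
  IsLawWithMellin ν (Set.Ioc 0 1)
    {q : ℂ | 0 < q.re + b₀ ∧ 0 < q.re + b₀ + b₁ ∧ 0 < q.re + b₀ + b₂ ∧ 0 < q.re + b₀ + b₁ + b₂}
    (barnesEta a₁ a₂ b₀ b₁ b₂)

/-- The law of `exp N`, with `N` normal of mean `0` and variance `v ≥ 0`. -/
noncomputable def lognormalLaw (v : ℝ) : Measure ℝ :=
  (gaussianReal 0 v.toNNReal).map Real.exp

/-- The law of `Y⁻¹` when `Y` has the law `ν`. -/
noncomputable def invLaw (ν : Measure ℝ) : Measure ℝ :=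
  ν.map (fun y => y⁻¹)

/-- The law of `c Y₁ Y₂ Y₃ Y₄` for independent `Yᵢ` with the laws `νᵢ`. -/
noncomputable def indepProductLaw (c : ℝ) (ν₁ ν₂ ν₃ ν₄ : Measure ℝ) : Measure ℝ :=
  (ν₁.prod (ν₂.prod (ν₃.prod ν₄))).map (fun p => c * p.1 * p.2.1 * p.2.2.1 * p.2.2.2)

/-- `μ` is infinitely divisible: for every `n ≥ 1` it is the law of a sum of `n` independent
identically distributed real random variables. -/
def IsInfinitelyDivisible (μ : Measure ℝ) : Prop :=
  ∀ n : ℕ, 1 ≤ n → ∃ ν : Measure ℝ, IsProbabilityMeasure ν ∧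
    (Measure.pi (fun _ : Fin n => ν)).map (fun y => ∑ i, y i) = μ

/-- The product of four ratios of double gamma functions. -/
noncomputable def masterMellin (a₁ a₂ x₁ x₂ : ℝ) (q : ℂ) : ℂ :=
  barnesGamma a₁ a₂ (x₁ - q) / barnesGamma a₁ a₂ x₁ *
  (barnesGamma a₁ a₂ (x₂ - q) / barnesGamma a₁ a₂ x₂) *
  (barnesGamma a₁ a₂ (a₁ + a₂ - q) / barnesGamma a₁ a₂ (a₁ + a₂)) *
  (barnesGamma a₁ a₂ (x₁ + x₂ - q) / barnesGamma a₁ a₂ (x₁ + x₂ - 2 * q))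

/-- `M` is a probability law on `(0, ∞)` with Mellin transform `masterMellin a₁ a₂ x₁ x₂` on the
half-plane `Re q < min (x₁, x₂, a₁ + a₂)`. -/
def IsMasterLaw (a₁ a₂ x₁ x₂ : ℝ) (M : Measure ℝ) : Prop :=
  IsLawWithMellin M (Set.Ioi 0) {q : ℂ | q.re < x₁ ∧ q.re < x₂ ∧ q.re < a₁ + a₂}
    (masterMellin a₁ a₂ x₁ x₂)

/-! The proof takes logarithms. Write L for `barnesLogGamma` and z = (x₁ + x₂)/2 - q. The second
differences `barnesS` of L for the three parameter sets, taken at -q, add up to L(x₁ - q) + L(x₂ -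
q) + L(a₁ + a₂ - q) + L(x₁ + x₂ - q) minus the four values of L at z, z + a₁/2, z + a₂/2, z + (a₁ +
a₂)/2. By `barnesLogGamma_duplication` these four values add up to L(2z) + log 2 · ζ₂(0, 2z). Since
ζ₂(0, ·) is a quadratic polynomial, the extra term, normalized at q = 0, is quadratic in q: its q²
part is the lognormal factor and its q part the power of 2 (`masterMellin_eq`).

Existence of the beta laws rests on a Malmsten formula, `barnesS_barnesLogGamma`: log η(q)/η(0) is
the integral of e^(-qt) - 1 against an explicit density, nonnegative as soon as b₁b₂ ≥ 0. Hence -log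
β₂,₂ should be the nonnegative infinitely divisible variable with this Lévy measure, which
`exists_subordinator` constructs as a sum of independent compound Poisson variables.

The identities for L come from identities between integrands: `RegularizedMellin` is linear, behaves
simply under dilation, and determines value and derivative at s = 0.

Uniqueness holds because the Mellin transform on the imaginary axis is the characteristic function
of the logarithm. The characteristic exponent of log M consists of a drift, a nondegenerate Gaussian
part and a Lévy integral. Multiplied by any r > 0 it is again such an exponent, whence infinite
divisibility; the Gaussian part gives absolute continuity. -/

open Filter Topology Asymptotics

/-! ### The domain of continuation and the identity theorem -/

/-- The half-plane `Re s > -1` without the points `1` and `2`. -/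
def barnesDomain : Set ℂ := {s : ℂ | -1 < s.re ∧ s ≠ 1 ∧ s ≠ 2}

theorem isOpen_barnesDomain : IsOpen barnesDomain :=
  (isOpen_lt continuous_const Complex.continuous_re).inter
    (isOpen_ne.inter isOpen_ne)

theorem zero_mem_barnesDomain : (0 : ℂ) ∈ barnesDomain := by
  simp [barnesDomain]

theorem mem_barnesDomain_of_two_lt {s : ℂ} (hs : 2 < s.re) : s ∈ barnesDomain := by
  refine ⟨by linarith, ?_, ?_⟩ <;> rintro rfl <;> norm_num at hs

/-- The identity theorem on `barnesDomain`. -/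
theorem eventuallyEq_nhds_zero_of_two_lt_re {Z W : ℂ → ℂ}
    (hZ : DifferentiableOn ℂ Z barnesDomain) (hW : DifferentiableOn ℂ W barnesDomain)
    (h : ∀ s : ℂ, 2 < s.re → Z s = W s) : Z =ᶠ[𝓝 0] W := by
  -- The punctured domain is not convex. Equality is carried from Re s > 2 to the upper part Im s >
  -- 0 through 3 + i, and from there to the strip -1 < Re s < 1 through i.
  have step : ∀ (U : Set ℂ) (z : ℂ), IsOpen U → Convex ℝ U → U ⊆ barnesDomain → z ∈ U →
      Z =ᶠ[𝓝 z] W → Set.EqOn Z W U := fun U z hU hc hs hz he =>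
    ((hZ.mono hs).analyticOnNhd hU).eqOn_of_preconnected_of_eventuallyEq
      ((hW.mono hs).analyticOnNhd hU) hc.isPreconnected hz he
  have o1 : IsOpen {s : ℂ | 2 < s.re} := isOpen_lt continuous_const Complex.continuous_re
  have o2 : IsOpen {s : ℂ | -1 < s.re ∧ 0 < s.im} :=
    (isOpen_lt continuous_const Complex.continuous_re).inter
      (isOpen_lt continuous_const Complex.continuous_im)
  have o3 : IsOpen {s : ℂ | -1 < s.re ∧ s.re < 1} :=
    (isOpen_lt continuous_const Complex.continuous_re).inter
      (isOpen_lt Complex.continuous_re continuous_const)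
  have e1 : Z =ᶠ[𝓝 (3 + Complex.I)] W := by
    filter_upwards [o1.mem_nhds (by simp; norm_num : (3 + Complex.I) ∈ {s : ℂ | 2 < s.re})]
      with s hs using h s hs
  have e2 := step {s : ℂ | -1 < s.re ∧ 0 < s.im} (3 + Complex.I) o2
    ((convex_halfSpace_re_gt (-1)).inter (convex_halfSpace_im_gt 0))
    (by
      rintro s ⟨h1, h2⟩
      refine ⟨h1, ?_, ?_⟩ <;> rintro rfl <;> norm_num at h2)
    (by constructor <;> simp; norm_num) e1
  have e3 : Z =ᶠ[𝓝 Complex.I] W := by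
    filter_upwards [o2.mem_nhds (by constructor <;> simp :
      Complex.I ∈ {s : ℂ | -1 < s.re ∧ 0 < s.im})] with s hs using e2 hs
  have e4 := step {s : ℂ | -1 < s.re ∧ s.re < 1} Complex.I o3
    ((convex_halfSpace_re_gt (-1)).inter (convex_halfSpace_re_lt 1))
    (by
      rintro s ⟨h1, h2⟩
      refine ⟨h1, ?_, ?_⟩ <;> rintro rfl <;> norm_num at h2)
    (by constructor <;> simp) e3
  filter_upwards [o3.mem_nhds (by constructor <;> simp :
      (0 : ℂ) ∈ {s : ℂ | -1 < s.re ∧ s.re < 1})] with s hs using e4 hs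

/-! ### Calculus of regularized Mellin transforms -/

/-- The function `s ↦ Γ(s)⁻¹ ∫₀^∞ t^(s-1) F(t) dt`, initially defined for `Re s > 2`, extends
holomorphically to `barnesDomain`, and its extension has value `V` and derivative `L` at `0`. -/
def RegularizedMellin (F : ℝ → ℂ) (V L : ℂ) : Prop :=
  ∃ Z : ℂ → ℂ, DifferentiableOn ℂ Z barnesDomain ∧
    (∀ s : ℂ, 2 < s.re → MellinConvergent F s ∧ Z s = (Complex.Gamma s)⁻¹ * mellin F s) ∧
    Z 0 = V ∧ deriv Z 0 = L

namespace RegularizedMellin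

variable {F G : ℝ → ℂ} {V L V' L' : ℂ}

/-- The identity theorem makes both numbers depend on the integrand alone. This turns every identity
between integrands into one between values of ζ₂(0, ·) and of L. -/
theorem unique (h : RegularizedMellin F V L) (h' : RegularizedMellin F V' L') :
    V = V' ∧ L = L' := by
  obtain ⟨Z, hZ, hs, rfl, rfl⟩ := h
  obtain ⟨W, hW, hs', rfl, rfl⟩ := h'
  have := eventuallyEq_nhds_zero_of_two_lt_re hZ hW
    (fun s h2 => (hs s h2).2.trans (hs' s h2).2.symm)
  exact ⟨this.eq_of_nhds, this.deriv_eq⟩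

theorem congr (h : RegularizedMellin F V L) (hFG : Set.EqOn F G (Set.Ioi 0)) :
    RegularizedMellin G V L := by
  obtain ⟨Z, hZ, hs, hV, hL⟩ := h
  refine ⟨Z, hZ, fun s h2 => ?_, hV, hL⟩
  have e : Set.EqOn (fun t : ℝ => (t : ℂ) ^ (s - 1) • F t) (fun t : ℝ => (t : ℂ) ^ (s - 1) • G t)
      (Set.Ioi 0) := fun t ht => by simp only [hFG ht]
  refine ⟨IntegrableOn.congr_fun (hs s h2).1 e measurableSet_Ioi, ?_⟩
  rw [(hs s h2).2, mellin, mellin, setIntegral_congr_fun measurableSet_Ioi e]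

theorem add (h : RegularizedMellin F V L) (h' : RegularizedMellin G V' L') :
    RegularizedMellin (fun t => F t + G t) (V + V') (L + L') := by
  obtain ⟨Z, hZ, hs, rfl, rfl⟩ := h
  obtain ⟨W, hW, hs', rfl, rfl⟩ := h'
  have hd := isOpen_barnesDomain.mem_nhds zero_mem_barnesDomain
  refine ⟨fun s => Z s + W s, hZ.add hW, fun s h2 => ?_, rfl,
    deriv_fun_add (hZ.differentiableAt hd) (hW.differentiableAt hd)⟩
  have := hasMellin_add (hs s h2).1 (hs' s h2).1
  refine ⟨this.1, ?_⟩
  simp only [this.2, (hs s h2).2, (hs' s h2).2, mul_add]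

theorem const_mul (c : ℂ) (h : RegularizedMellin F V L) :
    RegularizedMellin (fun t => c * F t) (c * V) (c * L) := by
  obtain ⟨Z, hZ, hs, rfl, rfl⟩ := h
  have hd := isOpen_barnesDomain.mem_nhds zero_mem_barnesDomain
  refine ⟨fun s => c * Z s, hZ.const_mul c, fun s h2 => ⟨(hs s h2).1.const_smul c, ?_⟩, rfl,
    deriv_const_mul c (hZ.differentiableAt hd)⟩
  have := mellin_const_smul F s c
  simp only [smul_eq_mul] at this
  simp only [this, (hs s h2).2]
  ring

theorem sub (h : RegularizedMellin F V L) (h' : RegularizedMellin G V' L') :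
    RegularizedMellin (fun t => F t - G t) (V - V') (L - L') := by
  simpa [sub_eq_add_neg] using h.add (h'.const_mul (-1))

/-- A dilation multiplies the Mellin transform by c^(-s), whose derivative at 0 is -log c. The term
log 2 · ζ₂(0, 2z) in the duplication formula arises here. -/
theorem comp_mul_left (h : RegularizedMellin F V L) {c : ℝ} (hc : 0 < c) :
    RegularizedMellin (fun t => F (c * t)) V (L - Real.log c * V) := by
  obtain ⟨Z, hZ, hs, rfl, rfl⟩ := h
  have hd := isOpen_barnesDomain.mem_nhds zero_mem_barnesDomain
  have hc' : (c : ℂ) ≠ 0 := by exact_mod_cast hc.ne'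
  have hp : ∀ s : ℂ, HasDerivAt (fun s : ℂ => (c : ℂ) ^ (-s))
      ((c : ℂ) ^ (-s) * Complex.log c * -1) s := fun s =>
    (hasDerivAt_neg s).const_cpow (Or.inl hc')
  refine ⟨fun s => (c : ℂ) ^ (-s) * Z s, fun s h => (hp s).differentiableAt.differentiableWithinAt.mul
    (hZ s h), fun s h2 => ⟨(MellinConvergent.comp_mul_left hc).2 (hs s h2).1, ?_⟩, by simp, ?_⟩
  · simp only [mellin_comp_mul_left F s hc, (hs s h2).2, smul_eq_mul]
    ring
  · rw [((hp 0).fun_mul (hZ.differentiableAt hd).hasDerivAt).deriv]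
    simp [Complex.ofReal_log hc.le]
    ring

/-- If `F` is small at `0`, no regularization is needed. -/
theorem of_isBigO (hF : ContinuousOn F (Set.Ioi 0)) {ε : ℝ} (hε : 0 < ε)
    (htop : F =O[atTop] fun t => Real.exp (-ε * t)) (hbot : F =O[𝓝[>] 0] fun t => t) :
    RegularizedMellin F 0 (mellin F 0) := by
  have hloc := hF.locallyIntegrableOn measurableSet_Ioi (μ := volume)
  -- The order t at 0 moves the abscissa of convergence to -1, so that s = 0 is an interior point.
  have hbot' : F =O[𝓝[>] 0] fun t : ℝ => t ^ (-(-1 : ℝ)) := by simpa using hbot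
  have hdiff : ∀ s : ℂ, -1 < s.re → DifferentiableAt ℂ (mellin F) s := fun s hs =>
    mellin_differentiableAt_of_isBigO_rpow_exp hε hloc htop hbot' hs
  refine ⟨fun s => (Complex.Gamma s)⁻¹ * mellin F s, fun s hs => ?_, fun s h2 => ⟨?_, rfl⟩, ?_, ?_⟩
  · exact (Complex.differentiable_one_div_Gamma s).differentiableWithinAt.mul
      (hdiff s hs.1).differentiableWithinAt
  · exact mellinConvergent_of_isBigO_rpow_exp hε hloc htop hbot' (by linarith)
  · simp
  -- 1/Γ has a simple zero at 0 with derivative 1, as 1/Γ(s) = s/Γ(s+1). So the product with the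
  -- Mellin transform has derivative `mellin F 0` there.
  · have h1 : HasDerivAt (fun s : ℂ => (Complex.Gamma s)⁻¹) 1 0 := by
      rw [funext Complex.one_div_Gamma_eq_self_mul_one_div_Gamma_add_one]
      have := (hasDerivAt_id (0 : ℂ)).mul
        (((Complex.differentiable_one_div_Gamma (0 + 1)).hasDerivAt).comp_add_const 0 1)
      simpa using! this
    rw [(h1.fun_mul (hdiff 0 (by simp)).hasDerivAt).deriv]
    simp

end RegularizedMellin

theorem norm_cexp_neg_mul_ofReal (w : ℂ) (t : ℝ) :
    ‖Complex.exp (-w * t)‖ = Real.exp (-w.re * t) := by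
  simp [Complex.norm_exp]

theorem isBigO_cexp_neg_mul_atTop (w : ℂ) :
    (fun t : ℝ => Complex.exp (-w * t)) =O[atTop] fun t => Real.exp (-w.re * t) :=
  IsBigO.of_bound 1 (Eventually.of_forall fun t => by
    rw [norm_cexp_neg_mul_ofReal, Real.norm_of_nonneg (Real.exp_nonneg _), one_mul])

theorem isBigO_cexp_neg_mul_one (w : ℂ) :
    (fun t : ℝ => Complex.exp (-w * t)) =O[𝓝[>] 0] fun _ => (1 : ℝ) := by
  have : ContinuousAt (fun t : ℝ => Complex.exp (-w * t)) 0 := by fun_prop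
  exact (this.tendsto.isBigO_one ℝ).mono nhdsWithin_le_nhds

/-! ### Exponentials divided by powers of t -/

section Exponential

variable {w : ℂ}

theorem mellinConvergent_cexp (hw : 0 < w.re) {s : ℂ} (hs : 0 < s.re) :
    MellinConvergent (fun t : ℝ => Complex.exp (-w * t)) s :=
  mellinConvergent_of_isBigO_rpow_exp (b := 0) hw
    ((by fun_prop : Continuous fun t : ℝ => Complex.exp (-w * t)).locallyIntegrable.locallyIntegrableOn _)
    (isBigO_cexp_neg_mul_atTop w) (by simpa using isBigO_cexp_neg_mul_one w) hs

theorem differentiableAt_mellin_cexp (hw : 0 < w.re) {s : ℂ} (hs : 0 < s.re) :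
    DifferentiableAt ℂ (mellin fun t : ℝ => Complex.exp (-w * t)) s :=
  mellin_differentiableAt_of_isBigO_rpow_exp (b := 0) hw
    ((by fun_prop : Continuous fun t : ℝ => Complex.exp (-w * t)).locallyIntegrable.locallyIntegrableOn _)
    (isBigO_cexp_neg_mul_atTop w) (by simpa using isBigO_cexp_neg_mul_one w) hs

theorem mellin_cexp_one (hw : 0 < w.re) : mellin (fun t : ℝ => Complex.exp (-w * t)) 1 = w⁻¹ := by
  have := integral_exp_mul_complex_Ioi (a := -w) (by simpa using hw) 0
  simpa [mellin] using this

/-- Integration by parts: t^s e^(-wt) vanishes at 0 and at infinity. The recursion provides the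
continuation to the left of Re s = 0. -/
theorem mellin_cexp_add_one (hw : 0 < w.re) {s : ℂ} (hs : 0 < s.re) :
    s * mellin (fun t : ℝ => Complex.exp (-w * t)) s =
      w * mellin (fun t : ℝ => Complex.exp (-w * t)) (s + 1) := by
  have i1 := (mellinConvergent_cexp hw hs).const_smul s
  have i2 := (mellinConvergent_cexp hw (s := s + 1) (by simp; linarith)).const_smul w
  have hs0 : s ≠ 0 := by rintro rfl; simp at hs
  have hderiv : ∀ t ∈ Set.Ioi (0 : ℝ), HasDerivAt
      (fun t : ℝ => (t : ℂ) ^ s * Complex.exp (-w * t))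
      ((t : ℂ) ^ (s - 1) • (s • Complex.exp (-w * t)) -
        (t : ℂ) ^ (s + 1 - 1) • (w • Complex.exp (-w * t))) t := by
    intro t ht
    have h1 := hasDerivAt_ofReal_cpow_const (x := t) (ne_of_gt ht) hs0
    have h2 : HasDerivAt (fun t : ℝ => Complex.exp (-w * t)) (Complex.exp (-w * t) * (-w * 1)) t :=
      ((Complex.ofRealCLM.hasDerivAt (x := t)).const_mul (-w)).cexp
    convert! h1.mul h2 using 1
    simp only [add_sub_cancel_right, smul_eq_mul]
    ring
  have h0 : ContinuousWithinAt (fun t : ℝ => (t : ℂ) ^ s * Complex.exp (-w * t)) (Set.Ici 0) 0 := by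
    refine ContinuousAt.continuousWithinAt ?_
    refine ContinuousAt.mul (Complex.continuousAt_ofReal_cpow_const _ _ (Or.inl hs)) ?_
    fun_prop
  have htop : Tendsto (fun t : ℝ => (t : ℂ) ^ s * Complex.exp (-w * t)) atTop (𝓝 0) := by
    rw [tendsto_zero_iff_norm_tendsto_zero]
    refine (tendsto_rpow_mul_exp_neg_mul_atTop_nhds_zero s.re w.re hw).congr' ?_
    filter_upwards [eventually_gt_atTop 0] with t ht
    rw [norm_mul, norm_cexp_neg_mul_ofReal, Complex.norm_cpow_eq_rpow_re_of_pos ht]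
  have key := integral_Ioi_of_hasDerivAt_of_tendsto h0 hderiv (i1.sub i2) htop
  rw [integral_sub i1 i2] at key
  have e1 := mellin_const_smul (fun t : ℝ => Complex.exp (-w * t)) s s
  have e2 := mellin_const_smul (fun t : ℝ => Complex.exp (-w * t)) (s + 1) w
  rw [mellin] at e1 e2
  rw [e1, e2] at key
  simp only [smul_eq_mul, Complex.ofReal_zero, Complex.zero_cpow hs0, zero_mul, sub_zero] at key
  exact sub_eq_zero.1 key

/-- The regularized Mellin transforms of `e^(-wt)`, `t⁻¹ e^(-wt)` and `t⁻² e^(-wt)`. -/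
theorem exists_regularizedMellin_cexp (hw : 0 < w.re) :
    (∃ L, RegularizedMellin (fun t => Complex.exp (-w * t)) 1 L) ∧
    (∃ L, RegularizedMellin (fun t => (t : ℂ)⁻¹ * Complex.exp (-w * t)) (-w) L) ∧
    (∃ L, RegularizedMellin (fun t => ((t : ℂ) ^ 2)⁻¹ * Complex.exp (-w * t)) (w ^ 2 / 2) L) := by
  obtain ⟨E, hE⟩ : ∃ E, E = mellin fun t : ℝ => Complex.exp (-w * t) := ⟨_, rfl⟩
  have hEd : ∀ s : ℂ, 0 < s.re → DifferentiableAt ℂ E s := fun s hs =>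
    hE ▸ differentiableAt_mellin_cexp hw hs
  have hErec : ∀ s : ℂ, 0 < s.re → s * E s = w * E (s + 1) := fun s hs =>
    hE ▸ mellin_cexp_add_one hw hs
  have hE1 : E 1 = w⁻¹ := hE ▸ mellin_cexp_one hw
  have hw0 : w ≠ 0 := by rintro rfl; simp at hw
  -- This is E(s)/Γ(s) after one use of the recursions of E and of Γ; in this form it is holomorphic
  -- for Re s > -1.
  set Z : ℂ → ℂ := fun s => w * E (s + 1) * (Complex.Gamma (s + 1))⁻¹ with hZ
  have hZd : DifferentiableOn ℂ Z barnesDomain := by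
    intro s hs
    have h1 : DifferentiableAt ℂ (fun s => E (s + 1)) s :=
      (hEd (s + 1) (by simpa using by linarith [hs.1])).comp s (by fun_prop)
    have h2 : DifferentiableAt ℂ (fun s => (Complex.Gamma (s + 1))⁻¹) s :=
      DifferentiableAt.comp (g := fun s => (Complex.Gamma s)⁻¹) s
        (Complex.differentiable_one_div_Gamma (s + 1)) (by fun_prop)
    exact ((h1.const_mul w).mul h2).differentiableWithinAt
  have hZE : ∀ s : ℂ, 2 < s.re → Z s = (Complex.Gamma s)⁻¹ * E s := by
    intro s hs
    have hs0 : s ≠ 0 := by rintro rfl; norm_num at hs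
    simp only [hZ]
    rw [← hErec s (by linarith), Complex.Gamma_add_one s hs0]
    field_simp
  have hZ0 : Z 0 = 1 := by
    simp [hZ, hE1, hw0]
  have hpow : ∀ (n : ℕ) (s : ℂ), (n : ℝ) < s.re →
      MellinConvergent (fun t : ℝ => ((t : ℂ) ^ n)⁻¹ * Complex.exp (-w * t)) s ∧
      mellin (fun t : ℝ => ((t : ℂ) ^ n)⁻¹ * Complex.exp (-w * t)) s = E (s - n) := by
    intro n s hs
    have e : (fun t : ℝ => ((t : ℂ) ^ n)⁻¹ * Complex.exp (-w * t)) =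
        fun t : ℝ => (t : ℂ) ^ (-n : ℂ) • Complex.exp (-w * t) := by
      ext t
      rw [Complex.cpow_neg, Complex.cpow_natCast, smul_eq_mul]
    rw [e, MellinConvergent.cpow_smul, mellin_cpow_smul, ← sub_eq_add_neg, ← hE]
    exact ⟨mellinConvergent_cexp hw (by simpa using hs), rfl⟩
  have hne1 : ∀ s ∈ barnesDomain, s - 1 ≠ 0 := fun s hs => sub_ne_zero.2 hs.2.1
  have hne2 : ∀ s ∈ barnesDomain, s - 2 ≠ 0 := fun s hs => sub_ne_zero.2 hs.2.2
  -- The powers of t shift s by 1 and 2, and the recursion gives E(s-1) = w E(s)/(s-1) and E(s-2) =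
  -- w² E(s)/((s-1)(s-2)). The denominators vanish only at the excluded points.
  refine ⟨⟨_, Z, hZd, fun s hs => ⟨mellinConvergent_cexp hw (by linarith), hE ▸ hZE s hs⟩, hZ0, rfl⟩,
    ⟨_, fun s => w * Z s / (s - 1), (hZd.const_mul w).div (by fun_prop) hne1, fun s hs => ?_, ?_, rfl⟩,
    ⟨_, fun s => w ^ 2 * Z s / ((s - 1) * (s - 2)), (hZd.const_mul _).div (by fun_prop)
      (fun s hs => mul_ne_zero (hne1 s hs) (hne2 s hs)), fun s hs => ?_, ?_, rfl⟩⟩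
  · have := hpow 1 s (by norm_num; linarith)
    simp only [pow_one, Nat.cast_one] at this
    refine ⟨this.1, ?_⟩
    have r1 := hErec (s - 1) (by simp; linarith)
    rw [sub_add_cancel] at r1
    have h1 := hne1 s (mem_barnesDomain_of_two_lt hs)
    simp only [this.2, hZE s hs]
    field_simp
    linear_combination -(Complex.Gamma s)⁻¹ * r1
  · simp only [hZ0, mul_one, zero_sub, div_neg, div_one]
  · have := hpow 2 s (by exact_mod_cast hs)
    refine ⟨this.1, ?_⟩
    have r1 := hErec (s - 1) (by simp; linarith)
    have r2 := hErec (s - 2) (by simp; linarith)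
    rw [sub_add_cancel] at r1
    rw [show s - 2 + 1 = s - 1 by ring] at r2
    have h1 := hne1 s (mem_barnesDomain_of_two_lt hs)
    have h2 := hne2 s (mem_barnesDomain_of_two_lt hs)
    rw [this.2, Nat.cast_ofNat]
    simp only [hZE s hs]
    field_simp
    linear_combination -(Complex.Gamma s)⁻¹ * (w * r1 + (s - 1) * r2)
  · simp only [hZ0]; simp

end Exponential

/-! ### Laurent expansion of the kernel at 0 -/

section Kernel

/-- The function `1 / ((1 - e^(-a₁ t)) (1 - e^(-a₂ t)))`. -/
noncomputable def barnesKernel (a₁ a₂ t : ℝ) : ℝ :=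
  ((1 - Real.exp (-(a₁ * t))) * (1 - Real.exp (-(a₂ * t))))⁻¹

theorem one_sub_exp_pos {a t : ℝ} (ha : 0 < a) (ht : 0 < t) : 0 < 1 - Real.exp (-(a * t)) := by
  simpa using mul_pos ha ht

theorem barnesKernel_pos {a₁ a₂ t : ℝ} (ha₁ : 0 < a₁) (ha₂ : 0 < a₂) (ht : 0 < t) :
    0 < barnesKernel a₁ a₂ t :=
  inv_pos.2 (mul_pos (one_sub_exp_pos ha₁ ht) (one_sub_exp_pos ha₂ ht))

theorem continuousOn_barnesKernel {a₁ a₂ : ℝ} (ha₁ : 0 < a₁) (ha₂ : 0 < a₂) :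
    ContinuousOn (barnesKernel a₁ a₂) (Set.Ioi 0) := by
  refine ContinuousOn.inv₀ (by fun_prop) fun t ht => ?_
  exact (mul_pos (one_sub_exp_pos ha₁ ht) (one_sub_exp_pos ha₂ ht)).ne'

theorem tendsto_barnesKernel_atTop {a₁ a₂ : ℝ} (ha₁ : 0 < a₁) (ha₂ : 0 < a₂) :
    Tendsto (barnesKernel a₁ a₂) atTop (𝓝 1) := by
  have h : ∀ a : ℝ, 0 < a → Tendsto (fun t : ℝ => 1 - Real.exp (-(a * t))) atTop (𝓝 (1 - 0)) :=
    fun a ha => tendsto_const_nhds.sub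
      (Real.tendsto_exp_neg_atTop_nhds_zero.comp (tendsto_id.const_mul_atTop ha))
  have := ((h a₁ ha₁).mul (h a₂ ha₂)).inv₀ (by norm_num)
  simpa only [sub_zero, mul_one, inv_one] using! this

/-- The Laurent polynomial approximating `1 / (1 - e^(-at))` at `0`. -/
theorem isBigO_inv_one_sub_exp {a : ℝ} (ha : 0 < a) :
    (fun t : ℝ => (1 - Real.exp (-(a * t)))⁻¹) =O[𝓝[>] 0] fun t : ℝ => t⁻¹ := by
  refine IsBigO.of_bound (a⁻¹ + 1) ?_
  filter_upwards [Ioo_mem_nhdsGT (zero_lt_one' ℝ)] with t ht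
  have h1 := one_sub_exp_pos ha ht.1
  -- From e^(at) ≥ 1 + at one gets 1 - e^(-at) ≥ at/(1 + at) ≥ at/(1 + a) for t < 1, whence the
  -- constant 1/a + 1.
  have h2 := Real.add_one_le_exp (a * t)
  have h3 : Real.exp (a * t) * Real.exp (-(a * t)) = 1 := by rw [← Real.exp_add]; simp
  have h4 := mul_pos ha ht.1
  have h5 : a * t ≤ (1 - Real.exp (-(a * t))) * (1 + a * t) := by
    nlinarith [Real.exp_pos (-(a * t))]
  rw [norm_inv, norm_inv, Real.norm_of_nonneg h1.le, Real.norm_of_nonneg ht.1.le,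
    inv_eq_one_div, div_le_iff₀ h1]
  have h6 : (a⁻¹ + 1) * t⁻¹ * (a * t) = 1 + a := by
    have := ht.1.ne'
    field_simp
  have h7 : 0 ≤ (a⁻¹ + 1) * t⁻¹ := by have := ht.1; positivity
  have h8 : a * t ≤ a := by nlinarith [ht.2]
  have h9 := mul_le_mul_of_nonneg_left h5 h7
  nlinarith [h9, mul_nonneg h7 h1.le]

/-- The difference is t⁻¹/(1 - e^(-at)) times t - p(t)(1 - e^(-at)), where p(t) = 1/a + t/2 +
at²/12. The coefficients of p cancel all orders below t⁴ in the second factor. -/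
theorem isBigO_inv_one_sub_exp_sub {a : ℝ} (ha : 0 < a) :
    (fun t : ℝ => (1 - Real.exp (-(a * t)))⁻¹ - (1 / a + t / 2 + a * t ^ 2 / 12) * t⁻¹)
      =O[𝓝[>] 0] fun t : ℝ => t ^ 2 := by
  have hr : (fun t : ℝ => Real.exp (-(a * t)) - (1 - a * t + (a * t) ^ 2 / 2 - (a * t) ^ 3 / 6))
      =O[𝓝[>] 0] fun t : ℝ => t ^ 4 := by
    have ht : Tendsto (fun t : ℝ => -(a * t)) (𝓝[>] 0) (𝓝 0) := by
      have : ContinuousAt (fun t : ℝ => -(a * t)) 0 := by fun_prop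
      simpa [ContinuousAt] using this.tendsto.mono_left nhdsWithin_le_nhds
    have := (Real.exp_sub_sum_range_isBigO_pow 4).comp_tendsto ht
    refine (this.congr_left fun t => ?_).trans (IsBigO.of_bound (a ^ 4)
      (Eventually.of_forall fun t => ?_))
    · simp [Finset.sum_range_succ, Nat.factorial]
      ring
    · simp [mul_pow, abs_of_pos ha]
  have hpoly : ∀ p : ℝ → ℝ, Continuous p → p =O[𝓝[>] 0] fun _ : ℝ => (1 : ℝ) := fun p hp =>
    (hp.continuousAt.tendsto.isBigO_one ℝ).mono nhdsWithin_le_nhds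
  -- This polynomial is what remains of t - p(t)(1 - e^(-at)) when the exponential is replaced by
  -- its cubic Taylor polynomial.
  have h1 : (fun t : ℝ => (-(a ^ 3 / 24) - a ^ 4 * t / 72) * t ^ 4) =O[𝓝[>] 0]
      fun t : ℝ => t ^ 4 := by
    simpa using (hpoly (fun t => -(a ^ 3 / 24) - a ^ 4 * t / 72) (by fun_prop)).mul
      (isBigO_refl (fun t : ℝ => t ^ 4) _)
  have h2 := hr.mul (hpoly (fun t => 1 / a + t / 2 + a * t ^ 2 / 12) (by fun_prop))
  simp only [mul_one] at h2
  have key := ((isBigO_inv_one_sub_exp ha).mul (isBigO_refl (fun t : ℝ => t⁻¹) _)).mul (h1.add h2)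
  refine key.congr' ?_ ?_
  · filter_upwards [self_mem_nhdsWithin] with t ht
    have h3 := (one_sub_exp_pos ha ht).ne'
    have h4 : t ≠ 0 := ne_of_gt ht
    field_simp
    ring
  · filter_upwards [self_mem_nhdsWithin] with t ht
    have h4 : t ≠ 0 := ne_of_gt ht
    field_simp

/-- The double pole of the kernel at `0`. -/
theorem isBigO_barnesKernel_sub {a₁ a₂ : ℝ} (ha₁ : 0 < a₁) (ha₂ : 0 < a₂) :
    (fun t : ℝ => barnesKernel a₁ a₂ t - (1 / (a₁ * a₂) * (t ^ 2)⁻¹ +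
      (a₁ + a₂) / (2 * a₁ * a₂) * t⁻¹ + (1 / 4 + a₁ / (12 * a₂) + a₂ / (12 * a₁))))
      =O[𝓝[>] 0] fun t : ℝ => t := by
  have hpoly : ∀ p : ℝ → ℝ, Continuous p → p =O[𝓝[>] 0] fun _ : ℝ => (1 : ℝ) := fun p hp =>
    (hp.continuousAt.tendsto.isBigO_one ℝ).mono nhdsWithin_le_nhds
  -- With A, B the two factors and P, Q their Laurent approximations, AB - PQ = (A - P)B + P(B - Q).
  -- The third estimate `h3` covers the terms of PQ of positive order.
  have h1 := (isBigO_inv_one_sub_exp_sub ha₁).mul (isBigO_inv_one_sub_exp ha₂)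
  have h2 := ((hpoly (fun t => 1 / a₁ + t / 2 + a₁ * t ^ 2 / 12) (by fun_prop)).mul
    (isBigO_refl (fun t : ℝ => t⁻¹) _)).mul (isBigO_inv_one_sub_exp_sub ha₂)
  have h3 := (hpoly (fun t => a₁ / 24 + a₂ / 24 + a₁ * a₂ * t / 144) (by fun_prop)).mul
    (isBigO_refl (fun t : ℝ => t) _)
  have e : (fun t : ℝ => t ^ 2 * t⁻¹) =ᶠ[𝓝[>] 0] fun t => t := by
    filter_upwards [self_mem_nhdsWithin] with t ht
    have h4 : t ≠ 0 := ne_of_gt ht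
    field_simp
  have h2' := h2.congr' EventuallyEq.rfl (g₂ := fun t => t) (by
    filter_upwards [e] with t ht
    linear_combination ht)
  have h3' := h3.congr_right (g₂ := fun t => t) (fun t => one_mul t)
  refine (((h1.congr' EventuallyEq.rfl e).add h2').add h3').congr' ?_ EventuallyEq.rfl
  filter_upwards [self_mem_nhdsWithin] with t ht
  have h4 : t ≠ 0 := ne_of_gt ht
  have h5 := (one_sub_exp_pos ha₁ ht).ne'
  have h6 := (one_sub_exp_pos ha₂ ht).ne'
  rw [barnesKernel]
  field_simp
  ring

end Kernel

/-! ### The double gamma function: duplication and Malmsten formulas -/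

section BarnesGamma

variable {a₁ a₂ : ℝ}

/-- The value at `s = 0` of the Barnes double zeta function. -/
noncomputable def barnesZetaZero (a₁ a₂ : ℝ) (w : ℂ) : ℂ :=
  w ^ 2 / (2 * a₁ * a₂) - (a₁ + a₂) * w / (2 * a₁ * a₂) +
    (1 / 4 + a₁ / (12 * a₂) + a₂ / (12 * a₁))

theorem isBigO_barnesKernel_atTop (ha₁ : 0 < a₁) (ha₂ : 0 < a₂) :
    (fun t => (barnesKernel a₁ a₂ t : ℂ)) =O[atTop] fun _ => (1 : ℝ) :=
  (Complex.continuous_ofReal.tendsto _).comp (tendsto_barnesKernel_atTop ha₁ ha₂) |>.isBigO_one ℝ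

theorem continuousOn_ofReal_barnesKernel (ha₁ : 0 < a₁) (ha₂ : 0 < a₂) :
    ContinuousOn (fun t => (barnesKernel a₁ a₂ t : ℂ)) (Set.Ioi 0) :=
  Complex.continuous_ofReal.comp_continuousOn (continuousOn_barnesKernel ha₁ ha₂)

/-- Once its Laurent part is subtracted, the kernel is O(t) at 0 and needs no regularization. The
three Laurent terms times e^(-wt) are the exponential cases, and they alone contribute to the value
at 0. -/
theorem exists_regularizedMellin_barnes (ha₁ : 0 < a₁) (ha₂ : 0 < a₂) {w : ℂ} (hw : 0 < w.re) :
    ∃ L, RegularizedMellin (fun t => Complex.exp (-w * t) * barnesKernel a₁ a₂ t)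
      (barnesZetaZero a₁ a₂ w) L := by
  obtain ⟨⟨L₀, h₀⟩, ⟨L₁, h₁⟩, ⟨L₂, h₂⟩⟩ := exists_regularizedMellin_cexp hw
  set c₂ : ℝ := 1 / (a₁ * a₂) with hc₂
  set c₁ : ℝ := (a₁ + a₂) / (2 * a₁ * a₂) with hc₁
  set c₀ : ℝ := 1 / 4 + a₁ / (12 * a₂) + a₂ / (12 * a₁) with hc₀
  set k : ℝ → ℝ := fun t => barnesKernel a₁ a₂ t - (c₂ * (t ^ 2)⁻¹ + c₁ * t⁻¹ + c₀) with hk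
  have hk0 : k =O[𝓝[>] 0] fun t : ℝ => t := isBigO_barnesKernel_sub ha₁ ha₂
  have hkc : ContinuousOn k (Set.Ioi 0) := by
    refine (continuousOn_barnesKernel ha₁ ha₂).sub ?_
    have h1 : ∀ t ∈ Set.Ioi (0 : ℝ), t ≠ 0 := fun t ht => ne_of_gt ht
    have h2 : ∀ t ∈ Set.Ioi (0 : ℝ), t ^ 2 ≠ 0 := fun t ht => pow_ne_zero 2 (h1 t ht)
    fun_prop (disch := assumption)
  have hktop : k =O[atTop] fun _ : ℝ => (1 : ℝ) := by
    have h1 := tendsto_inv_atTop_zero (𝕜 := ℝ)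
    have h2 := h1.comp (tendsto_pow_atTop (α := ℝ) two_ne_zero)
    exact ((tendsto_barnesKernel_atTop ha₁ ha₂).sub
      (((h2.const_mul c₂).add (h1.const_mul c₁)).add_const c₀)).isBigO_one ℝ
  have hrem : RegularizedMellin (fun t => Complex.exp (-w * t) * (k t : ℂ)) 0
      (mellin (fun t => Complex.exp (-w * t) * (k t : ℂ)) 0) := by
    refine RegularizedMellin.of_isBigO ?_ hw ?_ ?_
    · exact (by fun_prop : Continuous fun t : ℝ => Complex.exp (-w * t)).continuousOn.mul
        (Complex.continuous_ofReal.comp_continuousOn hkc)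
    · simpa using (isBigO_cexp_neg_mul_atTop w).mul (Complex.isBigO_ofReal_left.2 hktop)
    · simpa using (isBigO_cexp_neg_mul_one w).mul (Complex.isBigO_ofReal_left.2 hk0)
  have hsum := ((hrem.add (h₂.const_mul c₂)).add (h₁.const_mul c₁)).add (h₀.const_mul c₀)
  have hV : (0 : ℂ) + c₂ * (w ^ 2 / 2) + c₁ * -w + c₀ * 1 = barnesZetaZero a₁ a₂ w := by
    have h1 : (a₁ : ℂ) ≠ 0 := by exact_mod_cast ha₁.ne'
    have h2 : (a₂ : ℂ) ≠ 0 := by exact_mod_cast ha₂.ne'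
    simp only [barnesZetaZero, hc₀, hc₁, hc₂]
    push_cast
    field_simp
    ring
  rw [hV] at hsum
  refine ⟨_, hsum.congr fun t _ => ?_⟩
  simp only [hk]
  push_cast
  ring

theorem barnesZetaIntegral_eq_mellin (a₁ a₂ : ℝ) (s w : ℂ) :
    barnesZetaIntegral a₁ a₂ s w = (Complex.Gamma s)⁻¹ *
      mellin (fun t => Complex.exp (-w * t) * barnesKernel a₁ a₂ t) s := by
  rw [barnesZetaIntegral, mellin]
  congr 2
  ext t
  simp only [barnesKernel, smul_eq_mul]
  push_cast
  rw [div_eq_mul_inv, mul_assoc]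

/-- The continuation selected inside `barnesZeta` is one more witness for the same integrand, so its
value at 0 is the computed one. -/
theorem regularizedMellin_barnes (ha₁ : 0 < a₁) (ha₂ : 0 < a₂) {w : ℂ} (hw : 0 < w.re) :
    RegularizedMellin (fun t => Complex.exp (-w * t) * barnesKernel a₁ a₂ t)
      (barnesZetaZero a₁ a₂ w) (barnesLogGamma a₁ a₂ w) := by
  obtain ⟨L, hL⟩ := exists_regularizedMellin_barnes ha₁ ha₂ hw
  have hL' := hL
  obtain ⟨Z, hZ, hs, -, -⟩ := hL'
  have hex : ∃ Z : ℂ → ℂ, IsBarnesZetaContinuation a₁ a₂ w Z :=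
    ⟨Z, hZ, fun s h2 => (hs s h2).2.trans (barnesZetaIntegral_eq_mellin a₁ a₂ s w).symm⟩
  have hch := hex.choose_spec
  have key : RegularizedMellin (fun t => Complex.exp (-w * t) * barnesKernel a₁ a₂ t)
      (hex.choose 0) (deriv hex.choose 0) :=
    ⟨hex.choose, hch.1, fun s h2 => ⟨(hs s h2).1,
      (hch.2 s h2).trans (barnesZetaIntegral_eq_mellin a₁ a₂ s w)⟩, rfl, rfl⟩
  have e : barnesLogGamma a₁ a₂ w = deriv hex.choose 0 := by
    simp only [barnesLogGamma, barnesZeta, dif_pos hex]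
  rw [e, (hL.unique key).1]
  exact key

/-- The duplication formula for the logarithm of the double gamma function. -/
theorem barnesLogGamma_duplication (ha₁ : 0 < a₁) (ha₂ : 0 < a₂) {z : ℂ} (hz : 0 < z.re) :
    barnesLogGamma a₁ a₂ z + barnesLogGamma a₁ a₂ (z + (a₁ / 2 : ℝ)) +
      barnesLogGamma a₁ a₂ (z + (a₂ / 2 : ℝ)) +
      barnesLogGamma a₁ a₂ (z + (a₁ / 2 : ℝ) + (a₂ / 2 : ℝ)) =
    barnesLogGamma a₁ a₂ (2 * z) + Real.log 2 * barnesZetaZero a₁ a₂ (2 * z) := by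
  have h0 := regularizedMellin_barnes ha₁ ha₂ hz
  have h1 := regularizedMellin_barnes ha₁ ha₂ (w := z + (a₁ / 2 : ℝ)) (by simp; linarith)
  have h2 := regularizedMellin_barnes ha₁ ha₂ (w := z + (a₂ / 2 : ℝ)) (by simp; linarith)
  have h3 := regularizedMellin_barnes ha₁ ha₂ (w := z + (a₁ / 2 : ℝ) + (a₂ / 2 : ℝ))
    (by simp; linarith)
  have h4 := (regularizedMellin_barnes ha₁ ha₂ (w := 2 * z) (by simpa using hz)).comp_mul_left
    (c := 1 / 2) (by norm_num)
  -- With u = e^(-a₁t/2) and v = e^(-a₂t/2), the four integrands carry the factors 1, u, v, uv, and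
  -- (1+u)(1+v)/((1-u²)(1-v²)) = 1/((1-u)(1-v)) is the kernel at t/2.
  have key := (((h0.add h1).add h2).add h3).congr (G := fun t : ℝ =>
    Complex.exp (-(2 * z) * (1 / 2 * t : ℝ)) * barnesKernel a₁ a₂ (1 / 2 * t)) fun t ht => by
      set u := Real.exp (-(a₁ * (1 / 2 * t))) with hu
      set v := Real.exp (-(a₂ * (1 / 2 * t))) with hv
      have hu1 : 0 < 1 - u := one_sub_exp_pos ha₁ (half_pos ht |>.trans_eq (by ring))
      have hv1 : 0 < 1 - v := one_sub_exp_pos ha₂ (half_pos ht |>.trans_eq (by ring))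
      have hu0 : 0 < u := Real.exp_pos _
      have hv0 : 0 < v := Real.exp_pos _
      have eu : Real.exp (-(a₁ * t)) = u ^ 2 := by rw [hu, ← Real.exp_nat_mul]; congr 1; push_cast; ring
      have ev : Real.exp (-(a₂ * t)) = v ^ 2 := by rw [hv, ← Real.exp_nat_mul]; congr 1; push_cast; ring
      have e0 : Complex.exp (-(2 * z) * (1 / 2 * t : ℝ)) = Complex.exp (-z * t) := by
        congr 1; push_cast; ring
      have e1 : Complex.exp (-(z + (a₁ / 2 : ℝ)) * t) = Complex.exp (-z * t) * u := by
        rw [hu, Complex.ofReal_exp, ← Complex.exp_add]; congr 1; push_cast; ring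
      have e2 : Complex.exp (-(z + (a₂ / 2 : ℝ)) * t) = Complex.exp (-z * t) * v := by
        rw [hv, Complex.ofReal_exp, ← Complex.exp_add]; congr 1; push_cast; ring
      have e3 : Complex.exp (-(z + (a₁ / 2 : ℝ) + (a₂ / 2 : ℝ)) * t) =
          Complex.exp (-z * t) * u * v := by
        rw [hu, hv, Complex.ofReal_exp, Complex.ofReal_exp, ← Complex.exp_add, ← Complex.exp_add]
        congr 1; push_cast; ring
      have ek : (1 + u + v + u * v) * barnesKernel a₁ a₂ t = barnesKernel a₁ a₂ (1 / 2 * t) := by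
        rw [barnesKernel, barnesKernel, eu, ev, ← hu, ← hv]
        have h5 : 1 - u ^ 2 ≠ 0 := by
          have : 1 - u ^ 2 = (1 - u) * (1 + u) := by ring
          rw [this]; positivity
        have h6 : 1 - v ^ 2 ≠ 0 := by
          have : 1 - v ^ 2 = (1 - v) * (1 + v) := by ring
          rw [this]; positivity
        field_simp
        ring
      simp only [e0, e1, e2, e3]
      rw [← ek]
      push_cast
      ring
  have := (key.unique h4).2
  rw [this]
  simp [Real.log_inv]

/-- The density of the Lévy measure of `-log β₂,₂(a, b)`. -/
noncomputable def barnesLevyDensity (a₁ a₂ b₀ b₁ b₂ t : ℝ) : ℝ :=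
  t⁻¹ * (Real.exp (-(b₀ * t)) * (1 - Real.exp (-(b₁ * t))) * (1 - Real.exp (-(b₂ * t))) *
    barnesKernel a₁ a₂ t)

/-- The Malmsten-type formula for the logarithm of the Mellin transform of `β₂,₂(a, b)`. -/
theorem barnesS_barnesLogGamma (ha₁ : 0 < a₁) (ha₂ : 0 < a₂) {b₀ b₁ b₂ : ℝ} {q : ℂ}
    (h₀ : 0 < b₀) (h₁ : 0 < b₀ + b₁) (h₂ : 0 < b₀ + b₂) (h₃ : 0 < b₀ + b₁ + b₂)
    (hq₀ : 0 < q.re + b₀) (hq₁ : 0 < q.re + b₀ + b₁) (hq₂ : 0 < q.re + b₀ + b₂)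
    (hq₃ : 0 < q.re + b₀ + b₁ + b₂) :
    IntegrableOn (fun t : ℝ => (Complex.exp (-q * t) - 1) * barnesLevyDensity a₁ a₂ b₀ b₁ b₂ t)
      (Set.Ioi 0) ∧
    ∫ t : ℝ in Set.Ioi 0, (Complex.exp (-q * t) - 1) * barnesLevyDensity a₁ a₂ b₀ b₁ b₂ t =
      barnesS (barnesLogGamma a₁ a₂) b₀ b₁ b₂ q - barnesS (barnesLogGamma a₁ a₂) b₀ b₁ b₂ 0 := by
  have hre : ∀ x y : ℝ, -(x * y) = -x * y := fun x y => by ring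
  set F : ℝ → ℂ := fun t => (Complex.exp (-q * t) - 1) *
    (Complex.exp (-(b₀ : ℂ) * t) * (1 - Complex.exp (-(b₁ : ℂ) * t)) *
      (1 - Complex.exp (-(b₂ : ℂ) * t)) * barnesKernel a₁ a₂ t) with hF
  -- At s = 0 the Mellin weight is t⁻¹, exactly the factor in the Lévy density.
  have hFd : ∀ t : ℝ, (t : ℂ) ^ ((0 : ℂ) - 1) • F t =
      (Complex.exp (-q * t) - 1) * barnesLevyDensity a₁ a₂ b₀ b₁ b₂ t := by
    intro t
    rw [zero_sub, Complex.cpow_neg_one, hF, barnesLevyDensity, smul_eq_mul]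
    simp only [hre]
    push_cast
    ring
  have hFe : ∀ t : ℝ, F t =
      (Complex.exp (-(q + b₀) * t) - Complex.exp (-(q + b₀ + b₁) * t) -
        Complex.exp (-(q + b₀ + b₂) * t) + Complex.exp (-(q + b₀ + b₁ + b₂) * t) -
      (Complex.exp (-(0 + b₀) * t) - Complex.exp (-(0 + b₀ + b₁) * t) -
        Complex.exp (-(0 + b₀ + b₂) * t) + Complex.exp (-(0 + b₀ + b₁ + b₂) * t))) *
        barnesKernel a₁ a₂ t := by
    intro t
    simp only [hF, zero_add, neg_add, add_mul, Complex.exp_add]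
    ring
  have hcont : ContinuousOn F (Set.Ioi 0) :=
    (by fun_prop : Continuous fun t : ℝ => Complex.exp (-q * t) - 1).continuousOn.mul
      ((by fun_prop : Continuous fun t : ℝ => Complex.exp (-(b₀ : ℂ) * t) *
        (1 - Complex.exp (-(b₁ : ℂ) * t)) * (1 - Complex.exp (-(b₂ : ℂ) * t))).continuousOn.mul
        (continuousOn_ofReal_barnesKernel ha₁ ha₂))
  obtain ⟨ε, hε, hεle⟩ : ∃ ε : ℝ, 0 < ε ∧ (ε ≤ b₀ ∧ ε ≤ b₀ + b₁ ∧ ε ≤ b₀ + b₂ ∧ ε ≤ b₀ + b₁ + b₂) ∧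
      (ε ≤ q.re + b₀ ∧ ε ≤ q.re + b₀ + b₁ ∧ ε ≤ q.re + b₀ + b₂ ∧ ε ≤ q.re + b₀ + b₁ + b₂) := by
    refine ⟨min (min (min b₀ (b₀ + b₁)) (min (b₀ + b₂) (b₀ + b₁ + b₂)))
      (min (min (q.re + b₀) (q.re + b₀ + b₁)) (min (q.re + b₀ + b₂) (q.re + b₀ + b₁ + b₂))), ?_, ?_⟩
    · simp [*]
    · simp
  have hdecay : ∀ w : ℂ, ε ≤ w.re →
      (fun t : ℝ => Complex.exp (-w * t)) =O[atTop] fun t => Real.exp (-ε * t) := fun w hw =>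
    (isBigO_cexp_neg_mul_atTop w).trans <| IsBigO.of_bound 1 <| by
      filter_upwards [eventually_ge_atTop 0] with t ht
      rw [Real.norm_of_nonneg (Real.exp_nonneg _), Real.norm_of_nonneg (Real.exp_nonneg _), one_mul]
      exact Real.exp_le_exp.2 (by nlinarith)
  have htop : F =O[atTop] fun t => Real.exp (-ε * t) := by
    have h := (((((hdecay (q + b₀) (by simp [hεle])).sub
      (hdecay (q + b₀ + b₁) (by simp [hεle]))).sub
      (hdecay (q + b₀ + b₂) (by simp [hεle]))).add
      (hdecay (q + b₀ + b₁ + b₂) (by simp [hεle]))).sub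
      ((((hdecay (0 + b₀) (by simp [hεle])).sub
      (hdecay (0 + b₀ + b₁) (by simp [hεle]))).sub
      (hdecay (0 + b₀ + b₂) (by simp [hεle]))).add
      (hdecay (0 + b₀ + b₁ + b₂) (by simp [hεle])))).mul (isBigO_barnesKernel_atTop ha₁ ha₂)
    rw [funext hFe]
    simpa using h
  have hzero : ∀ w : ℂ, (fun t : ℝ => Complex.exp (-w * t) - 1) =O[𝓝[>] 0] fun t : ℝ => t := by
    intro w
    have h2 : HasDerivAt (fun t : ℝ => Complex.exp (-w * t)) (Complex.exp (-w * (0 : ℝ)) * (-w * 1)) 0 :=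
      ((Complex.ofRealCLM.hasDerivAt (x := (0 : ℝ))).const_mul (-w)).cexp
    simpa using h2.differentiableAt.isBigO_sub.mono nhdsWithin_le_nhds
  have hK : (fun t => (barnesKernel a₁ a₂ t : ℂ)) =O[𝓝[>] 0] fun t : ℝ => t⁻¹ * t⁻¹ := by
    refine Complex.isBigO_ofReal_left.2 ?_
    refine ((isBigO_inv_one_sub_exp ha₁).mul (isBigO_inv_one_sub_exp ha₂)).congr_left fun t => ?_
    rw [barnesKernel, mul_inv]
  have hbot : F =O[𝓝[>] 0] fun t : ℝ => t := by
    have hneg : ∀ w : ℂ, (fun t : ℝ => 1 - Complex.exp (-w * t)) =O[𝓝[>] 0] fun t : ℝ => t :=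
      fun w => ((hzero w).neg_left).congr_left fun t => by ring
    -- Three factors of order t against the double pole of the kernel leave order t.
    refine ((hzero q).mul ((((isBigO_cexp_neg_mul_one b₀).mul (hneg b₁)).mul (hneg b₂)).mul
      hK)).congr' EventuallyEq.rfl ?_
    filter_upwards [self_mem_nhdsWithin] with t ht
    have h4 : t ≠ 0 := ne_of_gt ht
    field_simp
  have hMC : MellinConvergent F 0 :=
    mellinConvergent_of_isBigO_rpow_exp (b := -1) hε
      (hcont.locallyIntegrableOn measurableSet_Ioi) htop (by simpa using hbot) (by simp)
  refine ⟨by simpa only [MellinConvergent, hFd] using hMC, ?_⟩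
  have hreg := RegularizedMellin.of_isBigO hcont hε htop hbot
  have hL : ∀ w : ℂ, ε ≤ w.re → RegularizedMellin
      (fun t => Complex.exp (-w * t) * barnesKernel a₁ a₂ t)
      (barnesZetaZero a₁ a₂ w) (barnesLogGamma a₁ a₂ w) := fun w hw =>
    regularizedMellin_barnes ha₁ ha₂ (hε.trans_le hw)
  have hsum := ((((hL (q + b₀) (by simp [hεle])).sub
      (hL (q + b₀ + b₁) (by simp [hεle]))).sub
      (hL (q + b₀ + b₂) (by simp [hεle]))).add
      (hL (q + b₀ + b₁ + b₂) (by simp [hεle]))).sub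
      ((((hL (0 + b₀) (by simp [hεle])).sub
      (hL (0 + b₀ + b₁) (by simp [hεle]))).sub
      (hL (0 + b₀ + b₂) (by simp [hεle]))).add
      (hL (0 + b₀ + b₁ + b₂) (by simp [hεle])))
  -- F is regularized in two ways: directly, where the derivative at 0 is a convergent integral, and
  -- as a combination of eight shifted kernels, where it is the combination of values of L.
  have h := (hreg.unique (hsum.congr fun t _ => by rw [hFe t]; ring)).2
  rw [mellin] at h
  simp only [hFd] at h
  exact h

end BarnesGamma

/-! ### Compound Poisson laws -/

section CompoundPoisson

variable {ν : Measure ℝ}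

/-- The convolution powers of a measure. -/
noncomputable def convPow (ν : Measure ℝ) : ℕ → Measure ℝ
  | 0 => Measure.dirac 0
  | n + 1 => convPow ν n ∗ ν

instance convPow_isFiniteMeasure [IsFiniteMeasure ν] (n : ℕ) : IsFiniteMeasure (convPow ν n) := by
  induction n with
  | zero => rw [convPow]; infer_instance
  | succ n ih => rw [convPow]; infer_instance

theorem ae_nonneg_conv {μ ν : Measure ℝ} [SFinite μ] [SFinite ν] (hμ : ∀ᵐ t ∂μ, 0 ≤ t)
    (hν : ∀ᵐ t ∂ν, 0 ≤ t) : ∀ᵐ t ∂(μ ∗ ν), 0 ≤ t := by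
  rw [Measure.conv, ae_map_iff (by fun_prop) measurableSet_Ici]
  filter_upwards [Measure.quasiMeasurePreserving_fst.ae hμ, Measure.quasiMeasurePreserving_snd.ae hν]
    with p h1 h2 using add_nonneg h1 h2

theorem ae_nonneg_convPow [IsFiniteMeasure ν] (hν : ∀ᵐ t ∂ν, 0 ≤ t) (n : ℕ) :
    ∀ᵐ t ∂(convPow ν n), 0 ≤ t := by
  induction n with
  | zero => rw [convPow, ae_dirac_iff measurableSet_Ici]
  | succ n ih => exact ae_nonneg_conv ih hν

theorem integral_cexp_conv {μ ν : Measure ℝ} [SFinite μ] [SFinite ν] {q : ℂ}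
    (hμ : Integrable (fun t : ℝ => Complex.exp (-q * t)) μ)
    (hν : Integrable (fun t : ℝ => Complex.exp (-q * t)) ν) :
    Integrable (fun t : ℝ => Complex.exp (-q * t)) (μ ∗ ν) ∧
      ∫ t : ℝ, Complex.exp (-q * t) ∂(μ ∗ ν) =
        (∫ t : ℝ, Complex.exp (-q * t) ∂μ) * ∫ t : ℝ, Complex.exp (-q * t) ∂ν := by
  have e : ∀ p : ℝ × ℝ, Complex.exp (-q * (p.1 + p.2 : ℝ)) =
      Complex.exp (-q * p.1) * Complex.exp (-q * p.2) := fun p => by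
    rw [← Complex.exp_add]; push_cast; ring_nf
  have hm : AEStronglyMeasurable (fun t : ℝ => Complex.exp (-q * t))
      (Measure.map (fun p : ℝ × ℝ => p.1 + p.2) (μ.prod ν)) :=
    (by fun_prop : Continuous fun t : ℝ => Complex.exp (-q * t)).aestronglyMeasurable
  constructor
  · rw [Measure.conv, integrable_map_measure hm (by fun_prop)]
    exact (hμ.mul_prod hν).congr (ae_of_all _ fun p => (e p).symm)
  · rw [Measure.conv, integral_map (by fun_prop) hm, ← integral_prod_mul]
    simp only [e]

theorem integral_cexp_convPow [IsFiniteMeasure ν] {q : ℂ}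
    (hν : Integrable (fun t : ℝ => Complex.exp (-q * t)) ν) (n : ℕ) :
    Integrable (fun t : ℝ => Complex.exp (-q * t)) (convPow ν n) ∧
      ∫ t : ℝ, Complex.exp (-q * t) ∂(convPow ν n) = (∫ t : ℝ, Complex.exp (-q * t) ∂ν) ^ n := by
  induction n with
  | zero =>
    rw [convPow]
    exact ⟨integrable_dirac (by simp), by simp⟩
  | succ n ih =>
    have := integral_cexp_conv ih.1 hν
    exact ⟨this.1, by rw [convPow, this.2, ih.2, pow_succ]⟩

/-- The norm of e^(-qt) is again an exponential, with Re q in place of q, so multiplicativity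
applies. It yields the summability needed for the Poisson series. -/
theorem integral_norm_cexp_convPow [IsFiniteMeasure ν] {q : ℂ}
    (hν : Integrable (fun t : ℝ => Complex.exp (-q * t)) ν) (n : ℕ) :
    ∫ t : ℝ, ‖Complex.exp (-q * t)‖ ∂(convPow ν n) = (∫ t : ℝ, ‖Complex.exp (-q * t)‖ ∂ν) ^ n := by
  have e : ∀ t : ℝ, ((‖Complex.exp (-q * t)‖ : ℝ) : ℂ) = Complex.exp (-(q.re : ℂ) * t) := fun t => by
    rw [norm_cexp_neg_mul_ofReal]; push_cast; rfl
  have hν' : Integrable (fun t : ℝ => Complex.exp (-(q.re : ℂ) * t)) ν := by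
    simp only [← e]
    exact Complex.ofRealCLM.integrable_comp hν.norm
  have := (integral_cexp_convPow hν' n).2
  simp only [← e] at this
  rw [integral_complex_ofReal, integral_complex_ofReal] at this
  exact_mod_cast this

/-- The law is e^(-r) Σ ν^(*n)/n! with r the total mass of ν. Its transform is e^(-r) exp(∫ e^(-qt)
dν), and r is absorbed as the -1 in the integrand. -/
theorem exists_compoundPoisson (ν : Measure ℝ) [IsFiniteMeasure ν] (hν : ∀ᵐ t ∂ν, 0 ≤ t) :
    ∃ P : Measure ℝ, IsProbabilityMeasure P ∧ (∀ᵐ t ∂P, 0 ≤ t) ∧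
      ∀ q : ℂ, Integrable (fun t : ℝ => Complex.exp (-q * t) - 1) ν →
        Integrable (fun t : ℝ => Complex.exp (-q * t)) P ∧
        ∫ t : ℝ, Complex.exp (-q * t) ∂P = Complex.exp (∫ t : ℝ, (Complex.exp (-q * t) - 1) ∂ν) := by
  set r := ν.real Set.univ with hr
  set c : ℕ → ℝ := fun n => Real.exp (-r) / n.factorial with hc
  have hc0 : ∀ n, 0 ≤ c n := fun n => by positivity
  set P : Measure ℝ := Measure.sum fun n => ENNReal.ofReal (c n) • convPow ν n with hP
  have key : ∀ q : ℂ, Integrable (fun t : ℝ => Complex.exp (-q * t) - 1) ν →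
        Integrable (fun t : ℝ => Complex.exp (-q * t)) P ∧
        ∫ t : ℝ, Complex.exp (-q * t) ∂P =
          Complex.exp (∫ t : ℝ, (Complex.exp (-q * t) - 1) ∂ν) := by
    intro q hq
    have hq' : Integrable (fun t : ℝ => Complex.exp (-q * t)) ν := by
      exact (hq.add (integrable_const (1 : ℂ))).congr (ae_of_all _ fun t => by simp)
    have hint : Integrable (fun t : ℝ => Complex.exp (-q * t)) P := by
      refine integrable_sum_measure (fun n =>
        (integral_cexp_convPow hq' n).1.smul_measure ENNReal.ofReal_ne_top) ?_
      simp only [integral_smul_measure, integral_norm_cexp_convPow hq', ENNReal.toReal_ofReal (hc0 _),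
        smul_eq_mul]
      refine ((Real.summable_pow_div_factorial (∫ t : ℝ, ‖Complex.exp (-q * t)‖ ∂ν)).mul_left
        (Real.exp (-r))).congr fun n => by ring
    refine ⟨hint, ?_⟩
    have h1 := hasSum_integral_measure hint
    have h2 : HasSum (fun n => ∫ t : ℝ, Complex.exp (-q * t) ∂(ENNReal.ofReal (c n) • convPow ν n))
        (Complex.exp (-r) * Complex.exp (∫ t : ℝ, Complex.exp (-q * t) ∂ν)) := by
      have h3 := (NormedSpace.expSeries_div_hasSum_exp
        (∫ t : ℝ, Complex.exp (-q * t) ∂ν)).mul_left (Complex.exp (-r))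
      rw [← Complex.exp_eq_exp_ℂ] at h3
      refine h3.congr_fun fun n => ?_
      rw [integral_smul_measure, (integral_cexp_convPow hq' n).2, ENNReal.toReal_ofReal (hc0 n)]
      simp only [hc, Complex.real_smul]
      push_cast
      ring
    rw [h1.unique h2, ← Complex.exp_add, integral_sub hq' (integrable_const 1)]
    congr 1
    simp [hr]
    ring
  refine ⟨P, ?_, ?_, key⟩
  -- The transform at q = 0 is the total mass.
  · have h0 := key 0 (by simp)
    simp only [neg_zero, zero_mul, Complex.exp_zero, sub_self, integral_zero] at h0
    have : IsFiniteMeasure P := by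
      have := (integrable_const_iff (c := (1 : ℂ))).1 h0.1
      simpa [isFiniteMeasure_iff] using this
    have h1 := h0.2
    rw [integral_const] at h1
    have h2 : P.real Set.univ = 1 := by simpa using congrArg Complex.re h1
    exact ⟨by rwa [measureReal_def, ENNReal.toReal_eq_one_iff] at h2⟩
  · rw [hP, Measure.ae_sum_iff]
    exact fun n => Measure.ae_smul_measure (ae_nonneg_convPow hν n) _

end CompoundPoisson

/-! ### Nonnegative infinitely divisible laws with infinite Lévy measure -/

section Subordinator

theorem integral_cexp_sum_range {Ω : Type*} [MeasurableSpace Ω] {μ : Measure Ω}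
    [IsProbabilityMeasure μ] {X : ℕ → Ω → ℝ} (hX : ∀ n, Measurable (X n)) (hind : iIndepFun X μ)
    {q : ℂ} (hint : ∀ n, Integrable (fun ω => Complex.exp (-q * X n ω)) μ) (N : ℕ) :
    Integrable (fun ω => Complex.exp (-q * (∑ n ∈ Finset.range N, X n ω : ℝ))) μ ∧
      ∫ ω, Complex.exp (-q * (∑ n ∈ Finset.range N, X n ω : ℝ)) ∂μ =
        ∏ n ∈ Finset.range N, ∫ ω, Complex.exp (-q * X n ω) ∂μ := by
  induction N with
  | zero => simp
  | succ N ih =>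
    have hS : Measurable fun ω => ∑ n ∈ Finset.range N, X n ω := by fun_prop
    have h1 : IndepFun (fun ω => ∑ n ∈ Finset.range N, X n ω) (X N) μ := by
      have := hind.indepFun_sum_range_succ hX N
      rwa [Finset.sum_fn] at this
    have hf : Measurable fun t : ℝ => Complex.exp (-q * t) := by fun_prop
    have h2 := h1.comp hf hf
    have e : (fun ω => Complex.exp (-q * (∑ n ∈ Finset.range (N + 1), X n ω : ℝ))) =
        fun ω => Complex.exp (-q * (∑ n ∈ Finset.range N, X n ω : ℝ)) *
          Complex.exp (-q * X N ω) := by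
      ext ω
      rw [Finset.sum_range_succ, ← Complex.exp_add]
      push_cast
      ring_nf
    rw [e]
    refine ⟨h2.integrable_mul ih.1 (hint N), ?_⟩
    rw [Finset.prod_range_succ, ← ih.2]
    exact h2.integral_fun_mul_eq_mul_integral ih.1.1 (hint N).1

/-- Existence of a nonnegative infinitely divisible distribution with a prescribed Lévy measure
that has exponential moments. -/
theorem exists_subordinator (ν : Measure ℝ) [SFinite ν] (hν : ∀ᵐ t ∂ν, 0 ≤ t) {m : ℝ} (hm : 0 < m)
    (hint : ∀ q : ℂ, -m < q.re → Integrable (fun t : ℝ => Complex.exp (-q * t) - 1) ν) :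
    ∃ P : Measure ℝ, IsProbabilityMeasure P ∧ (∀ᵐ t ∂P, 0 ≤ t) ∧
      ∀ q : ℂ, -m < q.re →
        Integrable (fun t : ℝ => Complex.exp (-q * t)) P ∧
        ∫ t : ℝ, Complex.exp (-q * t) ∂P =
          Complex.exp (∫ t : ℝ, (Complex.exp (-q * t) - 1) ∂ν) := by
  -- ν may be infinite near 0. It is cut into countably many finite measures, each giving a compound
  -- Poisson law, and independent variables with these laws are summed.
  have hle : ∀ n, sfiniteSeq ν n ≤ ν := fun n => by
    conv_rhs => rw [← sum_sfiniteSeq ν]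
    exact Measure.le_sum _ n
  choose P hPp hP0 hPq using fun n => exists_compoundPoisson (sfiniteSeq ν n)
    (ae_mono (hle n) hν)
  set μ := Measure.infinitePi P
  set S : ℕ → (ℕ → ℝ) → ℝ := fun N ω => ∑ n ∈ Finset.range N, ω n with hS
  have hSm : ∀ N, Measurable (S N) := fun N => by fun_prop
  have heval : ∀ n, MeasurePreserving (fun ω : ℕ → ℝ => ω n) μ (P n) := fun n =>
    measurePreserving_eval_infinitePi P n
  have hind : iIndepFun (fun n (ω : ℕ → ℝ) => ω n) μ :=
    iIndepFun_infinitePi (X := fun _ x => x) (fun _ => measurable_id)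
  have hcm : ∀ q : ℂ, Continuous fun t : ℝ => Complex.exp (-q * t) := fun q => by fun_prop
  set E : ℂ → ℂ := fun q => Complex.exp (∫ t : ℝ, (Complex.exp (-q * t) - 1) ∂ν)
  have hSint : ∀ q : ℂ, -m < q.re → (∀ N, Integrable (fun ω => Complex.exp (-q * S N ω)) μ) ∧
      Tendsto (fun N => ∫ ω, Complex.exp (-q * S N ω) ∂μ) atTop (𝓝 (E q)) := by
    intro q hq
    have h1 : ∀ n, Integrable (fun t : ℝ => Complex.exp (-q * t)) (P n) ∧
        ∫ t : ℝ, Complex.exp (-q * t) ∂(P n) =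
          Complex.exp (∫ t : ℝ, (Complex.exp (-q * t) - 1) ∂(sfiniteSeq ν n)) := fun n =>
      hPq n q ((hint q hq).mono_measure (hle n))
    have h2 := integral_cexp_sum_range (q := q) (fun n => measurable_pi_apply n) hind
      (fun n => (heval n).integrable_comp_of_integrable (h1 n).1)
    refine ⟨fun N => (h2 N).1, ?_⟩
    have h3 : ∀ n, ∫ ω, Complex.exp (-q * (ω n : ℝ)) ∂μ =
        Complex.exp (∫ t : ℝ, (Complex.exp (-q * t) - 1) ∂(sfiniteSeq ν n)) := fun n => by
      rw [← (h1 n).2, ← (heval n).map_eq,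
        integral_map (heval n).measurable.aemeasurable (hcm q).aestronglyMeasurable]
    have h4 := hasSum_integral_measure ((sum_sfiniteSeq ν).symm ▸ hint q hq)
    rw [sum_sfiniteSeq] at h4
    refine ((Complex.continuous_exp.tendsto _).comp h4.tendsto_sum_nat).congr fun N => ?_
    rw [(h2 N).2, Function.comp_apply, Complex.exp_sum]
    exact Finset.prod_congr rfl fun n _ => (h3 n).symm
  have hnn : ∀ᵐ ω ∂μ, ∀ n, 0 ≤ ω n := ae_all_iff.2 fun n =>
    (heval n).quasiMeasurePreserving.ae (hP0 n)
  have hmono : ∀ᵐ ω ∂μ, Monotone fun N => S N ω := by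
    filter_upwards [hnn] with ω hω
    exact monotone_nat_of_le_succ fun N => by
      simp only [hS, Finset.sum_range_succ]; linarith [hω N]
  have hnorm : ∀ (x y : ℝ), ‖Complex.exp (-(-x : ℂ) * y)‖ = Real.exp (x * y) := fun x y => by
    rw [norm_cexp_neg_mul_ofReal]; simp
  -- Monotone convergence: the exponential moments of the increasing partial sums converge, hence
  -- are bounded.
  have hsup : ∀ x : ℝ, 0 ≤ x → x < m →
      ∫⁻ ω, ⨆ N, ENNReal.ofReal (Real.exp (x * S N ω)) ∂μ < ⊤ := by
    intro x hx0 hxm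
    obtain ⟨hi, ht⟩ := hSint (-x) (by simpa using hxm)
    rw [lintegral_iSup' (fun N => by fun_prop) (by
      filter_upwards [hmono] with ω hω N N' h
      exact ENNReal.ofReal_le_ofReal (Real.exp_le_exp.2 (mul_le_mul_of_nonneg_left (hω h) hx0)))]
    obtain ⟨C, hC⟩ := ht.norm.bddAbove_range
    refine lt_of_le_of_lt (iSup_le fun N => ?_) (ENNReal.ofReal_lt_top (r := C))
    have e : (∫ ω, Complex.exp (-(-x : ℂ) * S N ω) ∂μ) =
        ((∫ ω, Real.exp (x * S N ω) ∂μ : ℝ) : ℂ) := by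
      rw [← integral_complex_ofReal]
      congr 1
      ext ω
      push_cast
      ring_nf
    have hiR : Integrable (fun ω => Real.exp (x * S N ω)) μ := by
      simpa only [hnorm] using (hi N).norm
    rw [← ofReal_integral_eq_lintegral_ofReal hiR (ae_of_all _ fun ω => Real.exp_nonneg _)]
    refine ENNReal.ofReal_le_ofReal (le_trans (le_trans (le_abs_self _) (le_of_eq ?_))
      (hC ⟨N, rfl⟩))
    simp only [e, Complex.norm_real, Real.norm_eq_abs]
  -- On unbounded paths this real supremum is the default value 0; such paths are negligible by the
  -- finite exponential moment at m/2.
  set Y : (ℕ → ℝ) → ℝ := fun ω => ⨆ N, S N ω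
  have hYm : Measurable Y := Measurable.iSup hSm
  have hlim : ∀ᵐ ω ∂μ, Tendsto (fun N => S N ω) atTop (𝓝 (Y ω)) := by
    have h1 := ae_lt_top' (by fun_prop) (hsup (m / 2) (by linarith) (by linarith)).ne
    filter_upwards [hmono, h1] with ω h2 h3
    refine tendsto_atTop_ciSup h2
      ⟨(⨆ N, ENNReal.ofReal (Real.exp (m / 2 * S N ω))).toReal / (m / 2), ?_⟩
    rintro _ ⟨N, rfl⟩
    rw [le_div_iff₀ (by linarith)]
    have h4 : Real.exp (m / 2 * S N ω) ≤ (⨆ N, ENNReal.ofReal (Real.exp (m / 2 * S N ω))).toReal :=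
      (ENNReal.ofReal_le_iff_le_toReal h3.ne).1
        (le_iSup (fun N => ENNReal.ofReal (Real.exp (m / 2 * S N ω))) N)
    linarith [Real.add_one_le_exp (m / 2 * S N ω)]
  have hSle : ∀ᵐ ω ∂μ, ∀ N, 0 ≤ S N ω ∧ S N ω ≤ Y ω := by
    filter_upwards [hmono, hlim, hnn] with ω h1 h2 h3 N
    exact ⟨Finset.sum_nonneg fun n _ => h3 n, h1.ge_of_tendsto h2 N⟩
  have hYint : ∀ x : ℝ, 0 ≤ x → x < m → Integrable (fun ω => Real.exp (x * Y ω)) μ := by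
    intro x hx0 hxm
    refine ⟨by fun_prop, ?_⟩
    rw [hasFiniteIntegral_iff_ofReal (ae_of_all _ fun ω => Real.exp_nonneg _)]
    refine lt_of_le_of_lt (lintegral_mono_ae ?_) (hsup x hx0 hxm)
    filter_upwards [hlim] with ω h
    have hc : Continuous fun y : ℝ => ENNReal.ofReal (Real.exp (x * y)) :=
      ENNReal.continuous_ofReal.comp (by fun_prop)
    exact le_of_tendsto ((hc.tendsto _).comp h) (Eventually.of_forall fun N =>
      le_iSup (fun N => ENNReal.ofReal (Real.exp (x * S N ω))) N)
  refine ⟨μ.map Y, Measure.isProbabilityMeasure_map hYm.aemeasurable, ?_, fun q hq => ?_⟩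
  · rw [ae_map_iff hYm.aemeasurable measurableSet_Ici]
    filter_upwards [hSle] with ω h using (h 0).1.trans (h 0).2
  · obtain ⟨hi, ht⟩ := hSint q hq
    have hx : max 0 (-q.re) < m := max_lt hm (by linarith)
    have hbound : ∀ᵐ ω ∂μ, ∀ N, ‖Complex.exp (-q * S N ω)‖ ≤ Real.exp (max 0 (-q.re) * Y ω) := by
      filter_upwards [hSle] with ω h N
      rw [norm_cexp_neg_mul_ofReal]
      refine Real.exp_le_exp.2 ?_
      calc -q.re * S N ω ≤ max 0 (-q.re) * S N ω :=
            mul_le_mul_of_nonneg_right (le_max_right _ _) (h N).1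
        _ ≤ _ := mul_le_mul_of_nonneg_left (h N).2 (le_max_left _ _)
    have hlimq : ∀ᵐ ω ∂μ, Tendsto (fun N => Complex.exp (-q * S N ω)) atTop
        (𝓝 (Complex.exp (-q * Y ω))) := by
      filter_upwards [hlim] with ω h using ((hcm q).tendsto _).comp h
    have hdom := hYint _ (le_max_left 0 (-q.re)) hx
    have hconv := tendsto_integral_of_dominated_convergence _ (fun N => (hi N).1) hdom
      (fun N => hbound.mono fun ω h => h N) hlimq
    constructor
    · rw [integrable_map_measure (hcm q).aestronglyMeasurable hYm.aemeasurable]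
      refine hdom.mono' (by fun_prop) ?_
      filter_upwards [hbound, hlimq] with ω h1 h2
      exact le_of_tendsto h2.norm (Eventually.of_forall h1)
    · rw [integral_map hYm.aemeasurable (hcm q).aestronglyMeasurable]
      exact tendsto_nhds_unique hconv ht

end Subordinator

/-! ### Laws on the half-line and their Mellin transforms -/

section MellinLaw

theorem ofReal_exp_cpow (x : ℝ) (q : ℂ) : ((Real.exp x : ℝ) : ℂ) ^ q = Complex.exp (x * q) := by
  rw [Complex.cpow_def_of_ne_zero (by exact_mod_cast (Real.exp_pos x).ne'), ← Complex.ofReal_log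
    (Real.exp_nonneg x), Real.log_exp]

theorem measurable_ofReal_cpow (q : ℂ) : Measurable fun y : ℝ => (y : ℂ) ^ q :=
  Complex.measurable_ofReal.pow_const q

variable {ν ν' : Measure ℝ} {S : Set ℝ} {D : Set ℂ} {φ ψ : ℂ → ℂ}

theorem IsLawWithMellin.ae_mem (h : IsLawWithMellin ν S D φ) : ∀ᵐ y ∂ν, y ∈ S :=
  measure_eq_zero_iff_ae_notMem.1 h.support |>.mono fun _ => not_not.1

theorem IsLawWithMellin.mono (h : IsLawWithMellin ν S D φ) {S' : Set ℝ} {D' : Set ℂ}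
    (hS : S ⊆ S') (hD : D' ⊆ D) (hφ : ∀ q ∈ D', φ q = ψ q) : IsLawWithMellin ν S' D' ψ where
  isProbabilityMeasure := h.isProbabilityMeasure
  support := measure_mono_null (Set.compl_subset_compl.2 hS) h.support
  integrable q hq := h.integrable q (hD hq)
  mellin q hq := (h.mellin q (hD hq)).trans (hφ q hq)

theorem IsLawWithMellin.charFun_map_log (h : IsLawWithMellin ν S D φ) (hS : S ⊆ Set.Ioi 0) {t : ℝ}
    (ht : (t * Complex.I : ℂ) ∈ D) : charFun (ν.map Real.log) t = φ (t * Complex.I) := by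
  rw [charFun_apply_real, integral_map Real.measurable_log.aemeasurable (by fun_prop),
    ← h.mellin _ ht]
  refine integral_congr_ae (h.ae_mem.mono fun y hy => ?_)
  have hy0 : 0 < y := hS hy
  beta_reduce
  rw [← Real.exp_log hy0, ofReal_exp_cpow, Real.log_exp]
  ring_nf

/-- The imaginary axis suffices: there the Mellin transform is the characteristic function of the
logarithm, and exp recovers the law on the positive half-line. -/
theorem IsLawWithMellin.unique (h : IsLawWithMellin ν S D φ) (h' : IsLawWithMellin ν' S D φ)
    (hS : S ⊆ Set.Ioi 0) (hD : ∀ t : ℝ, (t * Complex.I : ℂ) ∈ D) : ν = ν' := by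
  have := h.isProbabilityMeasure
  have := h'.isProbabilityMeasure
  have hlog : ν.map Real.log = ν'.map Real.log := by
    have := Measure.isProbabilityMeasure_map (μ := ν) Real.measurable_log.aemeasurable
    have := Measure.isProbabilityMeasure_map (μ := ν') Real.measurable_log.aemeasurable
    refine Measure.ext_of_charFun (funext fun t => ?_)
    rw [h.charFun_map_log hS (hD t), h'.charFun_map_log hS (hD t)]
  have hback : ∀ {μ : Measure ℝ}, IsLawWithMellin μ S D φ → (μ.map Real.log).map Real.exp = μ := by
    intro μ hμ
    rw [Measure.map_map Real.measurable_exp Real.measurable_log]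
    conv_rhs => rw [← Measure.map_id (μ := μ)]
    exact Measure.map_congr (hμ.ae_mem.mono fun y hy => Real.exp_log (hS hy))
  rw [← hback h, ← hback h', hlog]

theorem IsLawWithMellin.invLaw (h : IsLawWithMellin ν S D φ) (hS : S ⊆ Set.Ioi 0) :
    IsLawWithMellin (invLaw ν) (Set.Ioi 0) {q | -q ∈ D} (fun q => φ (-q)) := by
  have := h.isProbabilityMeasure
  have e : ∀ q : ℂ, (fun y : ℝ => ((y⁻¹ : ℝ) : ℂ) ^ q) =ᵐ[ν] fun y : ℝ => (y : ℂ) ^ (-q) := fun q =>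
    h.ae_mem.mono fun y hy => by
      have hy0 : 0 < y := hS hy
      change ((y⁻¹ : ℝ) : ℂ) ^ q = (y : ℂ) ^ (-q)
      rw [← Real.exp_log hy0, ← Real.exp_neg, ofReal_exp_cpow, ofReal_exp_cpow]
      push_cast
      ring_nf
  refine ⟨Measure.isProbabilityMeasure_map measurable_inv.aemeasurable, ?_, fun q hq => ?_,
    fun q hq => ?_⟩
  · rw [_root_.invLaw, Measure.map_apply measurable_inv measurableSet_Ioi.compl]
    have hsub : (fun y : ℝ => y⁻¹) ⁻¹' (Set.Ioi 0)ᶜ ⊆ Sᶜ := fun y hy hyS =>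
      hy (Set.mem_Ioi.2 (inv_pos.2 (Set.mem_Ioi.1 (hS hyS))))
    exact measure_mono_null hsub h.support
  · rw [_root_.invLaw, integrable_map_measure (measurable_ofReal_cpow q).aestronglyMeasurable
      measurable_inv.aemeasurable]
    exact (h.integrable _ hq).congr (e q).symm
  · rw [_root_.invLaw, integral_map measurable_inv.aemeasurable
      (measurable_ofReal_cpow q).aestronglyMeasurable, integral_congr_ae (e q), h.mellin _ hq]

theorem isLawWithMellin_lognormalLaw {v : ℝ} (hv : 0 ≤ v) :
    IsLawWithMellin (lognormalLaw v) (Set.Ioi 0) Set.univ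
      (fun q => Complex.exp (v * q ^ 2 / 2)) := by
  have hm := Real.measurable_exp.aemeasurable (μ := gaussianReal 0 v.toNNReal)
  refine ⟨Measure.isProbabilityMeasure_map hm, ?_, fun q _ => ?_, fun q _ => ?_⟩
  · rw [lognormalLaw, Measure.map_apply Real.measurable_exp measurableSet_Ioi.compl]
    convert! measure_empty (μ := gaussianReal 0 v.toNNReal)
    ext x
    simp [Real.exp_pos]
  · rw [lognormalLaw, integrable_map_measure (measurable_ofReal_cpow q).aestronglyMeasurable hm]
    simp only [Function.comp_def, ofReal_exp_cpow]
    have := integrable_cexp_mul_of_re_mem_integrableExpSet (X := id) (z := q)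
      (μ := gaussianReal 0 v.toNNReal) aemeasurable_id (integrable_exp_mul_gaussianReal q.re)
    simpa only [id, mul_comm] using this
  · rw [lognormalLaw, integral_map hm (measurable_ofReal_cpow q).aestronglyMeasurable]
    simp only [ofReal_exp_cpow]
    have := complexMGF_id_gaussianReal (μ := 0) (v := v.toNNReal) q
    simp only [complexMGF, id, Complex.ofReal_zero, mul_zero, zero_add] at this
    simpa only [mul_comm, Real.coe_toNNReal v hv] using! this

theorem isLawWithMellin_indepProductLaw {c : ℝ} (hc : 0 < c) {ν₁ ν₂ ν₃ ν₄ : Measure ℝ}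
    {D₁ D₂ D₃ D₄ : Set ℂ} {φ₁ φ₂ φ₃ φ₄ : ℂ → ℂ}
    (h₁ : IsLawWithMellin ν₁ (Set.Ioi 0) D₁ φ₁) (h₂ : IsLawWithMellin ν₂ (Set.Ioi 0) D₂ φ₂)
    (h₃ : IsLawWithMellin ν₃ (Set.Ioi 0) D₃ φ₃) (h₄ : IsLawWithMellin ν₄ (Set.Ioi 0) D₄ φ₄) :
    IsLawWithMellin (indepProductLaw c ν₁ ν₂ ν₃ ν₄) (Set.Ioi 0)
      {q | q ∈ D₁ ∧ q ∈ D₂ ∧ q ∈ D₃ ∧ q ∈ D₄}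
      (fun q => (c : ℂ) ^ q * (φ₁ q * (φ₂ q * (φ₃ q * φ₄ q)))) := by
  have := h₁.isProbabilityMeasure
  have := h₂.isProbabilityMeasure
  have := h₃.isProbabilityMeasure
  have := h₄.isProbabilityMeasure
  set f : ℝ × ℝ × ℝ × ℝ → ℝ := fun p => c * p.1 * p.2.1 * p.2.2.1 * p.2.2.2 with hf
  have hfm : Measurable f := by fun_prop
  set π := ν₁.prod (ν₂.prod (ν₃.prod ν₄)) with hπ
  have hpos : ∀ᵐ p ∂π, 0 < p.1 ∧ 0 < p.2.1 ∧ 0 < p.2.2.1 ∧ 0 < p.2.2.2 := by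
    have q1 : ∀ᵐ p ∂π, 0 < p.1 := Measure.quasiMeasurePreserving_fst.ae h₁.ae_mem
    have q2 : ∀ᵐ p ∂π, 0 < p.2.1 :=
      Measure.quasiMeasurePreserving_snd.ae (Measure.quasiMeasurePreserving_fst.ae h₂.ae_mem)
    have q3 : ∀ᵐ p ∂π, 0 < p.2.2.1 :=
      Measure.quasiMeasurePreserving_snd.ae (Measure.quasiMeasurePreserving_snd.ae
        (Measure.quasiMeasurePreserving_fst.ae h₃.ae_mem))
    have q4 : ∀ᵐ p ∂π, 0 < p.2.2.2 :=
      Measure.quasiMeasurePreserving_snd.ae (Measure.quasiMeasurePreserving_snd.ae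
        (Measure.quasiMeasurePreserving_snd.ae h₄.ae_mem))
    filter_upwards [q1, q2, q3, q4] with p e1 e2 e3 e4 using ⟨e1, e2, e3, e4⟩
  have e : ∀ q : ℂ, (fun p => (c : ℂ) ^ q * ((p.1 : ℂ) ^ q * ((p.2.1 : ℂ) ^ q *
      ((p.2.2.1 : ℂ) ^ q * (p.2.2.2 : ℂ) ^ q)))) =ᵐ[π] fun p => (f p : ℂ) ^ q := fun q => by
    filter_upwards [hpos] with p ⟨e1, e2, e3, e4⟩
    simp only [hf]
    rw [Complex.ofReal_mul, Complex.mul_cpow_ofReal_nonneg (by positivity) e4.le,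
      Complex.ofReal_mul, Complex.mul_cpow_ofReal_nonneg (by positivity) e3.le,
      Complex.ofReal_mul, Complex.mul_cpow_ofReal_nonneg (by positivity) e2.le,
      Complex.ofReal_mul, Complex.mul_cpow_ofReal_nonneg (by positivity) e1.le]
    ring
  refine ⟨Measure.isProbabilityMeasure_map hfm.aemeasurable, ?_, fun q hq => ?_, fun q hq => ?_⟩
  · rw [measure_eq_zero_iff_ae_notMem, indepProductLaw, ae_map_iff hfm.aemeasurable
      (by simp only [Set.mem_compl_iff, not_not]; exact measurableSet_Ioi)]
    filter_upwards [hpos] with p ⟨e1, e2, e3, e4⟩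
    simp only [Set.mem_compl_iff, not_not, Set.mem_Ioi]
    positivity
  · rw [indepProductLaw, integrable_map_measure (measurable_ofReal_cpow q).aestronglyMeasurable
      hfm.aemeasurable]
    refine Integrable.congr ?_ (e q)
    exact ((h₁.integrable q hq.1).mul_prod ((h₂.integrable q hq.2.1).mul_prod
      ((h₃.integrable q hq.2.2.1).mul_prod (h₄.integrable q hq.2.2.2)))).const_mul _
  · rw [indepProductLaw, integral_map hfm.aemeasurable
      (measurable_ofReal_cpow q).aestronglyMeasurable, ← integral_congr_ae (e q),
      integral_const_mul, hπ,
      integral_prod_mul (fun y : ℝ => (y : ℂ) ^ q) (fun p : ℝ × ℝ × ℝ => (p.1 : ℂ) ^ q *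
        ((p.2.1 : ℂ) ^ q * (p.2.2 : ℂ) ^ q)),
      integral_prod_mul (fun y : ℝ => (y : ℂ) ^ q) (fun p : ℝ × ℝ => (p.1 : ℂ) ^ q *
        (p.2 : ℂ) ^ q),
      integral_prod_mul (fun y : ℝ => (y : ℂ) ^ q) (fun y : ℝ => (y : ℂ) ^ q),
      h₁.mellin q hq.1, h₂.mellin q hq.2.1, h₃.mellin q hq.2.2.1, h₄.mellin q hq.2.2.2]

end MellinLaw

/-! ### Infinite divisibility from the characteristic exponent -/

section InfinitelyDivisible

/-- A law with Lévy triplet `r • (γ, v, ν)`. -/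
theorem exists_charFun_eq_exp {ν : Measure ℝ} [SFinite ν] (hν : ∀ᵐ t ∂ν, 0 ≤ t) {m : ℝ} (hm : 0 < m)
    (hint : ∀ q : ℂ, -m < q.re → Integrable (fun t : ℝ => Complex.exp (-q * t) - 1) ν)
    (γ : ℝ) {v : ℝ} (hv : 0 < v) {r : ℝ} (hr : 0 < r) :
    ∃ Q : Measure ℝ, IsProbabilityMeasure Q ∧ Q ≪ volume ∧ ∀ t : ℝ, charFun Q t =
      Complex.exp (r * (t * γ * Complex.I - v * t ^ 2 / 2 +
        ∫ x : ℝ, (Complex.exp (-(-(t * Complex.I)) * x) - 1) ∂ν)) := by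
  obtain ⟨P, hP, -, hPq⟩ := exists_subordinator (ENNReal.ofReal r • ν)
    (Measure.ae_smul_measure hν _) hm fun q hq => (hint q hq).smul_measure ENNReal.ofReal_ne_top
  have hv' : 0 < r * v := mul_pos hr hv
  -- The drift is put into the Gaussian mean. Convolution with a Gaussian of positive variance makes
  -- any law absolutely continuous.
  refine ⟨P ∗ gaussianReal (r * γ) (r * v).toNNReal, inferInstance,
    Measure.conv_absolutelyContinuous (gaussianReal_absolutelyContinuous _ (by simpa using hv')),
    fun t => ?_⟩
  have h := (hPq (-(t * Complex.I)) (by simpa using hm)).2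
  rw [charFun_conv, charFun_gaussianReal, charFun_apply_real]
  have e : ∫ x : ℝ, Complex.exp (t * x * Complex.I) ∂P =
      ∫ x : ℝ, Complex.exp (-(-(t * Complex.I)) * x) ∂P := by
    congr 1; ext x; ring_nf
  rw [e, h, ← Complex.exp_add, integral_smul_measure, ENNReal.toReal_ofReal hr.le,
    Real.coe_toNNReal _ hv'.le, Complex.real_smul]
  push_cast
  ring_nf

/-- Only r = 1/n is used. Working with a given exponent Ψ avoids choosing n-th roots of the
characteristic function. -/
theorem isInfinitelyDivisible_of_charFun {μ : Measure ℝ} [IsProbabilityMeasure μ] {Ψ : ℝ → ℂ}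
    (hμ : ∀ t, charFun μ t = Complex.exp (Ψ t))
    (h : ∀ r : ℝ, 0 < r → ∃ Q : Measure ℝ, IsProbabilityMeasure Q ∧
      ∀ t, charFun Q t = Complex.exp (r * Ψ t)) : IsInfinitelyDivisible μ := by
  intro n hn
  obtain ⟨Q, hQ, hQt⟩ := h (1 / n) (by positivity)
  refine ⟨Q, hQ, ?_⟩
  have : IsProbabilityMeasure ((Measure.pi fun _ : Fin n => Q).map fun y => ∑ i, y i) :=
    Measure.isProbabilityMeasure_map (by fun_prop)
  refine Measure.ext_of_charFun (funext fun t => ?_)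
  rw [charFun_map_sum_pi_eq_prod, Finset.prod_apply, hμ]
  simp only [hQt, Finset.prod_const, Finset.card_univ, Fintype.card_fin, ← Complex.exp_nat_mul]
  have : (n : ℂ) ≠ 0 := by exact_mod_cast (by omega : n ≠ 0)
  congr 1
  push_cast
  field_simp

end InfinitelyDivisible

/-! ### Existence of the Barnes beta laws -/

section BarnesBeta

variable {a₁ a₂ b₀ b₁ b₂ : ℝ}

/-- The Lévy measure of `-log β₂,₂(a, b)`. -/
noncomputable def barnesLevyMeasure (a₁ a₂ b₀ b₁ b₂ : ℝ) : Measure ℝ :=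
  (volume.restrict (Set.Ioi 0)).withDensity
    fun t => ENNReal.ofReal (barnesLevyDensity a₁ a₂ b₀ b₁ b₂ t)

instance barnesLevyMeasure_sfinite : SFinite (barnesLevyMeasure a₁ a₂ b₀ b₁ b₂) := by
  unfold barnesLevyMeasure; infer_instance

theorem ae_nonneg_barnesLevyMeasure : ∀ᵐ t ∂(barnesLevyMeasure a₁ a₂ b₀ b₁ b₂), 0 ≤ t :=
  (withDensity_absolutelyContinuous _ _).ae_le
    ((ae_restrict_mem measurableSet_Ioi).mono fun _ ht => le_of_lt ht)

theorem measurable_barnesLevyDensity : Measurable (barnesLevyDensity a₁ a₂ b₀ b₁ b₂) := by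
  unfold barnesLevyDensity barnesKernel; fun_prop

/-- The factors have the signs of b₁ and b₂. Both may be negative, as happens for b₁ = b₂ = (x₂ -
x₁)/2 when x₂ < x₁. -/
theorem one_sub_exp_mul_nonneg (hb : 0 ≤ b₁ * b₂) {t : ℝ} (ht : 0 < t) :
    0 ≤ (1 - Real.exp (-(b₁ * t))) * (1 - Real.exp (-(b₂ * t))) := by
  have hpos : ∀ b : ℝ, 0 ≤ b → 0 ≤ 1 - Real.exp (-(b * t)) := fun b hb => by
    simpa using mul_nonneg hb ht.le
  have hneg : ∀ b : ℝ, b ≤ 0 → 1 - Real.exp (-(b * t)) ≤ 0 := fun b hb => by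
    simpa using mul_nonpos_of_nonpos_of_nonneg hb ht.le
  rcases mul_nonneg_iff.1 hb with ⟨h1, h2⟩ | ⟨h1, h2⟩
  · exact mul_nonneg (hpos _ h1) (hpos _ h2)
  · exact mul_nonneg_of_nonpos_of_nonpos (hneg _ h1) (hneg _ h2)

theorem barnesLevyDensity_nonneg (ha₁ : 0 < a₁) (ha₂ : 0 < a₂) (hb : 0 ≤ b₁ * b₂) {t : ℝ}
    (ht : 0 < t) : 0 ≤ barnesLevyDensity a₁ a₂ b₀ b₁ b₂ t := by
  have h1 := one_sub_exp_mul_nonneg hb ht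
  have h2 := barnesKernel_pos ha₁ ha₂ ht
  rw [barnesLevyDensity, mul_assoc (Real.exp _)]
  positivity

/-- The domain of the Mellin transform of `β₂,₂(a, b)`. -/
def barnesBetaDomain (b₀ b₁ b₂ : ℝ) : Set ℂ :=
  {q : ℂ | 0 < q.re + b₀ ∧ 0 < q.re + b₀ + b₁ ∧ 0 < q.re + b₀ + b₂ ∧ 0 < q.re + b₀ + b₁ + b₂}

theorem integral_barnesLevyMeasure (ha₁ : 0 < a₁) (ha₂ : 0 < a₂) (hb : 0 ≤ b₁ * b₂)
    (h0 : (0 : ℂ) ∈ barnesBetaDomain b₀ b₁ b₂) {q : ℂ} (hq : q ∈ barnesBetaDomain b₀ b₁ b₂) :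
    Integrable (fun t : ℝ => Complex.exp (-q * t) - 1) (barnesLevyMeasure a₁ a₂ b₀ b₁ b₂) ∧
      ∫ t : ℝ, (Complex.exp (-q * t) - 1) ∂(barnesLevyMeasure a₁ a₂ b₀ b₁ b₂) =
        barnesS (barnesLogGamma a₁ a₂) b₀ b₁ b₂ q - barnesS (barnesLogGamma a₁ a₂) b₀ b₁ b₂ 0 := by
  simp only [barnesBetaDomain, Set.mem_ofPred_eq, Complex.zero_re, zero_add] at h0
  obtain ⟨h1, h2⟩ := barnesS_barnesLogGamma ha₁ ha₂ h0.1 h0.2.1 h0.2.2.1 h0.2.2.2 hq.1 hq.2.1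
    hq.2.2.1 hq.2.2.2
  have hm := (measurable_barnesLevyDensity (a₁ := a₁) (a₂ := a₂) (b₀ := b₀) (b₁ := b₁)
    (b₂ := b₂)).ennreal_ofReal
  have e : (fun t : ℝ => (Complex.exp (-q * t) - 1) * barnesLevyDensity a₁ a₂ b₀ b₁ b₂ t)
      =ᵐ[volume.restrict (Set.Ioi 0)] fun t : ℝ =>
        (ENNReal.ofReal (barnesLevyDensity a₁ a₂ b₀ b₁ b₂ t)).toReal •
          (Complex.exp (-q * t) - 1) := by
    filter_upwards [ae_restrict_mem measurableSet_Ioi] with t ht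
    rw [ENNReal.toReal_ofReal (barnesLevyDensity_nonneg ha₁ ha₂ hb ht), Complex.real_smul, mul_comm]
  constructor
  · rw [barnesLevyMeasure, integrable_withDensity_iff_integrable_smul' hm
      (ae_of_all _ fun t => ENNReal.ofReal_lt_top)]
    exact Integrable.congr h1 e
  · rw [barnesLevyMeasure, integral_withDensity_eq_integral_toReal_smul hm
      (ae_of_all _ fun t => ENNReal.ofReal_lt_top), ← h2]
    exact integral_congr_ae e.symm

theorem exists_halfPlane_subset_barnesBetaDomain (h0 : (0 : ℂ) ∈ barnesBetaDomain b₀ b₁ b₂) :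
    ∃ m : ℝ, 0 < m ∧ ∀ q : ℂ, -m < q.re ↔ q ∈ barnesBetaDomain b₀ b₁ b₂ := by
  simp only [barnesBetaDomain, Set.mem_ofPred_eq, Complex.zero_re, zero_add] at h0
  refine ⟨min (min b₀ (b₀ + b₁)) (min (b₀ + b₂) (b₀ + b₁ + b₂)), by simp [h0], fun q => ?_⟩
  simp only [barnesBetaDomain, Set.mem_ofPred_eq, neg_lt, lt_min_iff]
  constructor
  · rintro ⟨⟨_, _⟩, _, _⟩; refine ⟨?_, ?_, ?_, ?_⟩ <;> linarith
  · rintro ⟨_, _, _, _⟩; refine ⟨⟨?_, ?_⟩, ?_, ?_⟩ <;> linarith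

/-- The law is that of e^(-Y), with Y the nonnegative variable whose Lévy measure is read off the
Malmsten formula; Y ≥ 0 places it on (0, 1]. -/
theorem exists_isBarnesBeta (ha₁ : 0 < a₁) (ha₂ : 0 < a₂) (hb : 0 ≤ b₁ * b₂)
    (h0 : (0 : ℂ) ∈ barnesBetaDomain b₀ b₁ b₂) : ∃ β, IsBarnesBeta a₁ a₂ b₀ b₁ b₂ β := by
  obtain ⟨m, hm, hmq⟩ := exists_halfPlane_subset_barnesBetaDomain h0
  have hint := fun q hq => integral_barnesLevyMeasure ha₁ ha₂ hb h0 ((hmq q).1 hq)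
  obtain ⟨P, hP, hP0, hPq⟩ := exists_subordinator (barnesLevyMeasure a₁ a₂ b₀ b₁ b₂)
    ae_nonneg_barnesLevyMeasure hm fun q hq => (hint q hq).1
  have hexp : Measurable fun y : ℝ => Real.exp (-y) := by fun_prop
  have e : ∀ (q : ℂ) (y : ℝ), ((Real.exp (-y) : ℝ) : ℂ) ^ q = Complex.exp (-q * y) := fun q y => by
    rw [ofReal_exp_cpow]; push_cast; ring_nf
  refine ⟨P.map fun y => Real.exp (-y), Measure.isProbabilityMeasure_map hexp.aemeasurable, ?_,
    fun q hq => ?_, fun q hq => ?_⟩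
  · rw [measure_eq_zero_iff_ae_notMem, ae_map_iff hexp.aemeasurable
      (by simp only [Set.mem_compl_iff, not_not]; exact measurableSet_Ioc)]
    filter_upwards [hP0] with y hy
    simp [Real.exp_pos, hy]
  · rw [integrable_map_measure (measurable_ofReal_cpow q).aestronglyMeasurable hexp.aemeasurable]
    simpa only [Function.comp_def, e] using (hPq q ((hmq q).2 hq)).1
  · rw [integral_map hexp.aemeasurable (measurable_ofReal_cpow q).aestronglyMeasurable]
    simp only [e]
    rw [(hPq q ((hmq q).2 hq)).2, (hint q ((hmq q).2 hq)).2, barnesEta]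

end BarnesBeta

/-! ### Factorization of the Mellin transform -/

section MasterLaw

variable {a₁ a₂ x₁ x₂ : ℝ}

/-- The middle terms are -2L(z) and -2L(z + (a₁+a₂)/2) from the first and third sums. The second sum
contributes L at these two points with sign +, and at z + a₁/2 and z + a₂/2 with sign -, so the
duplication quadruple remains with sign -. -/
theorem barnesS_add_barnesS_add_barnesS (ha₁ : 0 < a₁) (ha₂ : 0 < a₂) {q : ℂ}
    (hq : 0 < (-q + ((x₁ + x₂) / 2 : ℝ)).re) :
    barnesS (barnesLogGamma a₁ a₂) x₁ ((x₂ - x₁) / 2) ((x₂ - x₁) / 2) (-q) +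
      barnesS (barnesLogGamma a₁ a₂) ((x₁ + x₂) / 2) (a₁ / 2) (a₂ / 2) (-q) +
      barnesS (barnesLogGamma a₁ a₂) (a₁ + a₂) ((x₁ + x₂ - a₁ - a₂) / 2)
        ((x₁ + x₂ - a₁ - a₂) / 2) (-q) =
    barnesLogGamma a₁ a₂ (x₁ - q) + barnesLogGamma a₁ a₂ (x₂ - q) +
      barnesLogGamma a₁ a₂ (a₁ + a₂ - q) + barnesLogGamma a₁ a₂ (x₁ + x₂ - q) -
      barnesLogGamma a₁ a₂ (x₁ + x₂ - 2 * q) -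
      Real.log 2 * barnesZetaZero a₁ a₂ (x₁ + x₂ - 2 * q) := by
  have hd := barnesLogGamma_duplication ha₁ ha₂ hq
  have e1 : 2 * (-q + ((x₁ + x₂) / 2 : ℝ)) = x₁ + x₂ - 2 * q := by push_cast; ring
  rw [e1] at hd
  simp only [barnesS]
  have e2 : -q + (x₁ : ℂ) + ((x₂ - x₁) / 2 : ℝ) = -q + ((x₁ + x₂) / 2 : ℝ) := by push_cast; ring
  have e3 : -q + ((x₁ + x₂) / 2 : ℝ) + ((x₂ - x₁) / 2 : ℝ) = x₂ - q := by push_cast; ring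
  have e4 : -q + ((a₁ + a₂ : ℝ) : ℂ) + ((x₁ + x₂ - a₁ - a₂) / 2 : ℝ) =
    -q + ((x₁ + x₂) / 2 : ℝ) + (a₁ / 2 : ℝ) + (a₂ / 2 : ℝ) := by push_cast; ring
  have e5 : -q + ((x₁ + x₂) / 2 : ℝ) + (a₁ / 2 : ℝ) + (a₂ / 2 : ℝ) +
    ((x₁ + x₂ - a₁ - a₂) / 2 : ℝ) = x₁ + x₂ - q := by push_cast; ring
  have e6 : -q + (x₁ : ℂ) = x₁ - q := by ring
  have e7 : -q + ((a₁ + a₂ : ℝ) : ℂ) = a₁ + a₂ - q := by push_cast; ring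
  rw [e2, e3, e4, e5, e6, e7, ← sub_eq_iff_eq_add.2 hd]
  ring

theorem masterMellin_eq (ha₁ : 0 < a₁) (ha₂ : 0 < a₂) (hx₁ : 0 < x₁) (hx₂ : 0 < x₂) {q : ℂ}
    (hq₁ : q.re < x₁) (hq₂ : q.re < x₂) :
    masterMellin a₁ a₂ x₁ x₂ q =
      (((2 : ℝ) ^ (-((2 * (x₁ + x₂) - (a₁ + a₂)) / (a₁ * a₂))) : ℝ) : ℂ) ^ q *
      (Complex.exp ((4 * Real.log 2 / (a₁ * a₂) : ℝ) * q ^ 2 / 2) *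
      (barnesEta a₁ a₂ x₁ ((x₂ - x₁) / 2) ((x₂ - x₁) / 2) (-q) *
      (barnesEta a₁ a₂ ((x₁ + x₂) / 2) (a₁ / 2) (a₂ / 2) (-q) *
      barnesEta a₁ a₂ (a₁ + a₂) ((x₁ + x₂ - a₁ - a₂) / 2) ((x₁ + x₂ - a₁ - a₂) / 2) (-q)))) := by
  have h1 := barnesS_add_barnesS_add_barnesS (x₁ := x₁) (x₂ := x₂) ha₁ ha₂ (q := q)
    (by simp only [Complex.add_re, Complex.neg_re, Complex.ofReal_re]; linarith)
  have h2 := barnesS_add_barnesS_add_barnesS (x₁ := x₁) (x₂ := x₂) ha₁ ha₂ (q := 0)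
    (by simp only [Complex.add_re, Complex.neg_re, Complex.ofReal_re, Complex.zero_re]; linarith)
  simp only [neg_zero, sub_zero, mul_zero] at h2
  -- Times log 2, the q² part is vq²/2 with v = 4 log 2/(a₁a₂), and the q part is q times the
  -- logarithm of the power of 2.
  have hz : barnesZetaZero a₁ a₂ (x₁ + x₂ - 2 * q) - barnesZetaZero a₁ a₂ (x₁ + x₂) =
      (2 * q ^ 2 - (2 * (x₁ + x₂) - (a₁ + a₂)) * q) / (a₁ * a₂) := by
    have h1 : (a₁ : ℂ) ≠ 0 := by exact_mod_cast ha₁.ne'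
    have h2 : (a₂ : ℂ) ≠ 0 := by exact_mod_cast ha₂.ne'
    simp only [barnesZetaZero]
    field_simp
    ring
  rw [Real.rpow_def_of_pos two_pos, ofReal_exp_cpow]
  simp only [masterMellin, barnesGamma, barnesEta, ← Complex.exp_sub, ← Complex.exp_add]
  congr 1
  push_cast
  linear_combination -h1 + h2 + (Real.log 2 : ℂ) * hz

theorem isMasterLaw_indepProductLaw (ha₁ : 0 < a₁) (ha₂ : 0 < a₂) (hx₁ : 0 < x₁) (hx₂ : 0 < x₂)
    {β₁ β₂ β₃ : Measure ℝ}
    (h₁ : IsBarnesBeta a₁ a₂ x₁ ((x₂ - x₁) / 2) ((x₂ - x₁) / 2) β₁)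
    (h₂ : IsBarnesBeta a₁ a₂ ((x₁ + x₂) / 2) (a₁ / 2) (a₂ / 2) β₂)
    (h₃ : IsBarnesBeta a₁ a₂ (a₁ + a₂) ((x₁ + x₂ - a₁ - a₂) / 2)
      ((x₁ + x₂ - a₁ - a₂) / 2) β₃) :
    IsMasterLaw a₁ a₂ x₁ x₂
      (indepProductLaw ((2 : ℝ) ^ (-((2 * (x₁ + x₂) - (a₁ + a₂)) / (a₁ * a₂))))
        (lognormalLaw (4 * Real.log 2 / (a₁ * a₂))) (invLaw β₁) (invLaw β₂) (invLaw β₃)) := by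
  have hv : 0 ≤ 4 * Real.log 2 / (a₁ * a₂) := by
    have := Real.log_pos one_lt_two
    positivity
  have hS : Set.Ioc (0 : ℝ) 1 ⊆ Set.Ioi 0 := Set.Ioc_subset_Ioi_self
  refine (isLawWithMellin_indepProductLaw (Real.rpow_pos_of_pos two_pos _)
    (isLawWithMellin_lognormalLaw hv) (h₁.invLaw hS) (h₂.invLaw hS) (h₃.invLaw hS)).mono
    subset_rfl ?_ fun q hq => (masterMellin_eq ha₁ ha₂ hx₁ hx₂ hq.1 hq.2.1).symm
  rintro q ⟨hq₁, hq₂, hq₃⟩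
  refine ⟨Set.mem_univ _, ?_, ?_, ?_⟩ <;>
  · simp only [Set.mem_ofPred_eq, Complex.neg_re]
    refine ⟨?_, ?_, ?_, ?_⟩ <;> linarith

end MasterLaw

/-! ### The main theorem -/

theorem mainTheorem1 (a₁ a₂ x₁ x₂ : ℝ) (ha₁ : 0 < a₁) (ha₂ : 0 < a₂)
    (hx₁ : 0 < x₁) (hx₂ : 0 < x₂) :
    ∃ M : Measure ℝ,
      IsMasterLaw a₁ a₂ x₁ x₂ M ∧
      (∀ M' : Measure ℝ, IsMasterLaw a₁ a₂ x₁ x₂ M' → M' = M) ∧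
      (∃ β₁ β₂ β₃ : Measure ℝ,
        IsBarnesBeta a₁ a₂ x₁ ((x₂ - x₁) / 2) ((x₂ - x₁) / 2) β₁ ∧
        IsBarnesBeta a₁ a₂ ((x₁ + x₂) / 2) (a₁ / 2) (a₂ / 2) β₂ ∧
        IsBarnesBeta a₁ a₂ (a₁ + a₂) ((x₁ + x₂ - a₁ - a₂) / 2) ((x₁ + x₂ - a₁ - a₂) / 2) β₃) ∧
      (∀ β₁ β₂ β₃ : Measure ℝ,
        IsBarnesBeta a₁ a₂ x₁ ((x₂ - x₁) / 2) ((x₂ - x₁) / 2) β₁ →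
        IsBarnesBeta a₁ a₂ ((x₁ + x₂) / 2) (a₁ / 2) (a₂ / 2) β₂ →
        IsBarnesBeta a₁ a₂ (a₁ + a₂) ((x₁ + x₂ - a₁ - a₂) / 2) ((x₁ + x₂ - a₁ - a₂) / 2) β₃ →
        M = indepProductLaw ((2 : ℝ) ^ (-((2 * (x₁ + x₂) - (a₁ + a₂)) / (a₁ * a₂))))
          (lognormalLaw (4 * Real.log 2 / (a₁ * a₂)))
          (invLaw β₁) (invLaw β₂) (invLaw β₃)) ∧
      M.map Real.log ≪ volume ∧
      IsInfinitelyDivisible (M.map Real.log) := by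
  have hdom₁ : (0 : ℂ) ∈ barnesBetaDomain x₁ ((x₂ - x₁) / 2) ((x₂ - x₁) / 2) := by
    simp only [barnesBetaDomain, Set.mem_ofPred_eq, Complex.zero_re]
    refine ⟨?_, ?_, ?_, ?_⟩ <;> linarith
  have hdom₂ : (0 : ℂ) ∈ barnesBetaDomain ((x₁ + x₂) / 2) (a₁ / 2) (a₂ / 2) := by
    simp only [barnesBetaDomain, Set.mem_ofPred_eq, Complex.zero_re]
    refine ⟨?_, ?_, ?_, ?_⟩ <;> linarith
  have hdom₃ : (0 : ℂ) ∈ barnesBetaDomain (a₁ + a₂) ((x₁ + x₂ - a₁ - a₂) / 2)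
      ((x₁ + x₂ - a₁ - a₂) / 2) := by
    simp only [barnesBetaDomain, Set.mem_ofPred_eq, Complex.zero_re]
    refine ⟨?_, ?_, ?_, ?_⟩ <;> linarith
  have hb₁ := mul_self_nonneg ((x₂ - x₁) / 2)
  have hb₂ : 0 ≤ a₁ / 2 * (a₂ / 2) := by positivity
  have hb₃ := mul_self_nonneg ((x₁ + x₂ - a₁ - a₂) / 2)
  obtain ⟨β₁, h₁⟩ := exists_isBarnesBeta ha₁ ha₂ hb₁ hdom₁
  obtain ⟨β₂, h₂⟩ := exists_isBarnesBeta ha₁ ha₂ hb₂ hdom₂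
  obtain ⟨β₃, h₃⟩ := exists_isBarnesBeta ha₁ ha₂ hb₃ hdom₃
  have hI : ∀ t : ℝ, (t * Complex.I : ℂ) ∈ {q : ℂ | q.re < x₁ ∧ q.re < x₂ ∧ q.re < a₁ + a₂} := by
    intro t
    simp [hx₁, hx₂, add_pos ha₁ ha₂]
  have hM := isMasterLaw_indepProductLaw ha₁ ha₂ hx₁ hx₂ h₁ h₂ h₃
  have huniq : ∀ M' M'' : Measure ℝ, IsMasterLaw a₁ a₂ x₁ x₂ M' → IsMasterLaw a₁ a₂ x₁ x₂ M'' →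
      M' = M'' := fun M' M'' h h' => IsLawWithMellin.unique h h' subset_rfl hI
  set c : ℝ := (2 : ℝ) ^ (-((2 * (x₁ + x₂) - (a₁ + a₂)) / (a₁ * a₂))) with hc
  have hc0 : 0 < c := Real.rpow_pos_of_pos two_pos _
  set v : ℝ := 4 * Real.log 2 / (a₁ * a₂) with hv
  have hv0 : 0 < v := by
    have := Real.log_pos one_lt_two
    positivity
  set M := indepProductLaw c (lognormalLaw v) (invLaw β₁) (invLaw β₂) (invLaw β₃)
  have := hM.isProbabilityMeasure
  have hMlog : IsProbabilityMeasure (M.map Real.log) :=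
    Measure.isProbabilityMeasure_map Real.measurable_log.aemeasurable
  -- Independent factors add their Lévy measures, so this is the Lévy measure of log M; each factor
  -- X is a reciprocal, hence its jumps are positive.
  set ν := barnesLevyMeasure a₁ a₂ x₁ ((x₂ - x₁) / 2) ((x₂ - x₁) / 2) +
    (barnesLevyMeasure a₁ a₂ ((x₁ + x₂) / 2) (a₁ / 2) (a₂ / 2) +
    barnesLevyMeasure a₁ a₂ (a₁ + a₂) ((x₁ + x₂ - a₁ - a₂) / 2) ((x₁ + x₂ - a₁ - a₂) / 2)) with hν
  have hν0 : ∀ᵐ t ∂ν, 0 ≤ t := by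
    simp only [hν, ae_add_measure_iff]
    exact ⟨ae_nonneg_barnesLevyMeasure, ae_nonneg_barnesLevyMeasure, ae_nonneg_barnesLevyMeasure⟩
  obtain ⟨m₁, hm₁, hq₁⟩ := exists_halfPlane_subset_barnesBetaDomain hdom₁
  obtain ⟨m₂, hm₂, hq₂⟩ := exists_halfPlane_subset_barnesBetaDomain hdom₂
  obtain ⟨m₃, hm₃, hq₃⟩ := exists_halfPlane_subset_barnesBetaDomain hdom₃
  have hint : ∀ q : ℂ, -min m₁ (min m₂ m₃) < q.re →
      Integrable (fun t : ℝ => Complex.exp (-q * t) - 1) ν := by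
    intro q hq
    simp only [neg_lt, lt_min_iff] at hq
    exact (integral_barnesLevyMeasure ha₁ ha₂ hb₁ hdom₁ ((hq₁ q).1 (by linarith))).1.add_measure
      ((integral_barnesLevyMeasure ha₁ ha₂ hb₂ hdom₂ ((hq₂ q).1 (by linarith))).1.add_measure
      (integral_barnesLevyMeasure ha₁ ha₂ hb₃ hdom₃ ((hq₃ q).1 (by linarith))).1)
  have hlaw := fun r (hr : 0 < r) => exists_charFun_eq_exp hν0 (lt_min hm₁ (lt_min hm₂ hm₃)) hint
    (Real.log c) hv0 hr
  have hchar : ∀ t : ℝ, charFun (M.map Real.log) t =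
      Complex.exp (t * Real.log c * Complex.I - v * t ^ 2 / 2 +
        ∫ x : ℝ, (Complex.exp (-(-(t * Complex.I)) * x) - 1) ∂ν) := by
    intro t
    have i₁ := integral_barnesLevyMeasure ha₁ ha₂ hb₁ hdom₁ (q := -(t * Complex.I))
      ((hq₁ _).1 (by simpa using hm₁))
    have i₂ := integral_barnesLevyMeasure ha₁ ha₂ hb₂ hdom₂ (q := -(t * Complex.I))
      ((hq₂ _).1 (by simpa using hm₂))
    have i₃ := integral_barnesLevyMeasure ha₁ ha₂ hb₃ hdom₃ (q := -(t * Complex.I))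
      ((hq₃ _).1 (by simpa using hm₃))
    rw [IsLawWithMellin.charFun_map_log hM subset_rfl (hI t),
      masterMellin_eq ha₁ ha₂ hx₁ hx₂ (hI t).1 (hI t).2.1, hν,
      integral_add_measure i₁.1 (i₂.1.add_measure i₃.1), integral_add_measure i₂.1 i₃.1,
      i₁.2, i₂.2, i₃.2, ← hc, ← hv, ← Real.exp_log hc0, ofReal_exp_cpow, Real.log_exp]
    simp only [barnesEta, ← Complex.exp_add]
    congr 1
    rw [mul_pow, Complex.I_sq]
    ring
  -- M was built from one choice of beta laws; any other choice again gives a master law, hence the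
  -- same M.
  refine ⟨M, hM, fun M' hM' => huniq _ _ hM' hM, ⟨β₁, β₂, β₃, h₁, h₂, h₃⟩,
    fun β₁' β₂' β₃' h₁' h₂' h₃' =>
      huniq _ _ hM (isMasterLaw_indepProductLaw ha₁ ha₂ hx₁ hx₂ h₁' h₂' h₃'), ?_, ?_⟩
  · obtain ⟨Q, hQ, hQac, hQt⟩ := hlaw 1 one_pos
    have e : M.map Real.log = Q := Measure.ext_of_charFun (funext fun t => by
      rw [hchar, hQt, Complex.ofReal_one, one_mul])
    rwa [e]
  · refine isInfinitelyDivisible_of_charFun hchar fun r hr => ?_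
    obtain ⟨Q, hQ, -, hQt⟩ := hlaw r hr
    exact ⟨Q, hQ, hQt⟩
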